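/- **Setting.** Let $\Omega=(0,L_1)\times(0,L_2)$ with $L_1,L_2>0$, let $\gamma_c,\gamma_e\ge 0$, and let $\mathsf J=\mathsf J_c-\mathsf J_e$, where $\mathsf J_c,\mathsf J_e\in C^\infty(\mathbb R^2)$ are $\Omega$-periodic, even and non-negative. Put $(\mathsf J*\phi)(\mathbf x)=\int_\Omega \mathsf J(\mathbf y)\phi(\mathbf x-\mathbf y)\,d\mathbf y$ for $\Omega$-periodic $\phi$, and assume $\mathsf J*1=\int_\Omega\mathsf J>0$ and $\gamma_c-\gamma_e+\mathsf J*1>0$. The nonlocal Cahn–Hilliard equation is $$\partial_t\phi=\Delta\bigl(\phi^3+\gamma_c\phi-\gamma_e\phi+(\mathsf J*1)\phi-\mathsf J*\phi\bigr).$$ **Scheme.** Let $h>0$ and let $m,n$ be positive integers with $L_1=mh$, $L_2=nh$; put $p_r=(r-\tfrac12)h$. Grid functions $\phi=(\phi_{i,j})_{i,j\in\mathbb Z}$ are periodic with periods $m$ in $i$ and $n$ in $j$, $\Delta_h$ is the five-point discrete Laplacian, and $\|\phi\|_2=\bigl(h^2\sum_{i=1}^m\sum_{j=1}^n\phi_{i,j}^2\bigr)^{1/2}$.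 For $f_{k+\frac12,l+\frac12}=\mathsf f(p_{k+\frac12},p_{l+\frac12})$, with $(f,\mathsf f)=(J,\mathsf J),(J_c,\mathsf J_c),(J_e,\mathsf J_e)$, put $$(f\star\phi)_{i,j}=h^2\sum_{k=1}^m\sum_{l=1}^n f_{k+\frac12,l+\frac12}\,\phi_{i-k,j-l},\qquad B_c=J_c\star\mathbf 1+\gamma_c,\qquad B_e=J_e\star\mathbf 1+\gamma_e$$ ($B_c$ and $B_e$ are constants that depend on $h$). With time step $s>0$, the fully discrete second-order convex splitting scheme is, for $k\ge 0$, $$\phi^{k+1}-\phi^k=s\,\Delta_h\Bigl(\tfrac14\bigl((\phi^k)^2+(\phi^{k+1})^2\bigr)(\phi^k+\phi^{k+1})+B_c\,\phi^{k+1/2}-B_e\,\hat\phi^{k+1/2}-J\star\hat\phi^{k+1/2}\Bigr),$$ where $\phi^{k+1/2}=\tfrac12(\phi^k+\phi^{k+1})$, $\hat\phi^{k+1/2}=\tfrac32\phi^k-\tfrac12\phi^{k-1}$ and $\phi^{-1}:=\phi^0$. **Theorem.** Suppose that there are $\alpha_0>0$ and $h_1>0$ such that $B_c-3B_e\ge\alpha_0$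 on every such grid with $h\le h_1$. Let $0<T<\infty$ and let $\Phi=\Phi(x_1,x_2,t)$ be smooth on $\mathbb R^2\times[0,T]$, $\Omega$-periodic in space, and a solution of the nonlocal Cahn–Hilliard equation for $0<t\le T$. Let $\kappa>0$. Then there are $h_0,s_0>0$ and a constant $C>0$, independent of $h$ and $s$, such that the following holds for all grids and time steps with $0<h\le h_0$, $0<s\le s_0$ and $s\le\kappa h$. If $\phi^0,\phi^1,\dots$ is a periodic solution of the scheme up to time $T$ with initial value $\phi^0_{i,j}=\Phi(p_i,p_j,0)$, then $$\|\Phi^l-\phi^l\|_2\le C\,(h^2+s^2),\qquad \Phi^l_{i,j}:=\Phi(p_i,p_j,l s),$$ for all positive integers $l$ with $l\,s\le T$. -/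

import Mathlib

open MeasureTheory Set InnerProductSpace
open scoped ContDiff

noncomputable section

namespace NonlocalCH

/-! ### The continuous problem -/

/-- The plane, with its Euclidean structure. -/
abbrev Plane : Type := EuclideanSpace ℝ (Fin 2)

/-- The data of the two-dimensional nonlocal Cahn--Hilliard equation: the side lengths of the
rectangle `Ω = (0, L₁) × (0, L₂)`, the two parts `Jc`, `Je` of the convolution kernel and the
constants `γc`, `γe`. -/
structure Model where
  L₁ : ℝ
  L₂ : ℝ
  Jc : Plane → ℝ
  Je : Plane → ℝ
  γc : ℝ
  γe : ℝ

/-- `f : ℝ² → ℝ` is `Ω`-periodic, for `Ω = (0, L₁) × (0, L₂)`. -/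
def IsPeriodic (L₁ L₂ : ℝ) (f : Plane → ℝ) : Prop :=
  ∀ x : Plane, f (x + !₂[L₁, 0]) = f x ∧ f (x + !₂[0, L₂]) = f x

/-- The rectangle `(0, L₁) × (0, L₂)`. -/
def rect (L₁ L₂ : ℝ) : Set Plane := {x | x 0 ∈ Ioo 0 L₁ ∧ x 1 ∈ Ioo 0 L₂}

namespace Model

variable (P : Model)

/-- The domain `Ω`. -/
def domain : Set Plane := rect P.L₁ P.L₂

/-- The convolution kernel `J = Jc - Je`. -/
def J : Plane → ℝ := fun x => P.Jc x - P.Je x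

/-- The periodic convolution `(J * φ)(x) = ∫_Ω J(y) φ(x - y) dy`. -/
def conv (J φ : Plane → ℝ) (x : Plane) : ℝ := ∫ y in P.domain, J y * φ (x - y)

/-- The constant `J * 1 = ∫_Ω J`. -/
def mass (J : Plane → ℝ) : ℝ := ∫ y in P.domain, J y

/-- The chemical potential `w = φ³ + γc φ - γe φ + (J * 1) φ - J * φ`. -/
def chemicalPotential (φ : Plane → ℝ) (x : Plane) : ℝ :=
  φ x ^ 3 + P.γc * φ x - P.γe * φ x + P.mass P.J * φ x - P.conv P.J φ x

/-- The standing assumptions on the data: `Jc` and `Je` are smooth, `Ω`-periodic, non-negative and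
even, `∫_Ω J > 0`, `γc, γe ≥ 0`, and the positive diffusivity condition
`γc - γe + J * 1 > 0` holds. -/
structure Admissible : Prop where
  L₁_pos : 0 < P.L₁
  L₂_pos : 0 < P.L₂
  Jc_smooth : ContDiff ℝ ∞ P.Jc
  Je_smooth : ContDiff ℝ ∞ P.Je
  Jc_periodic : IsPeriodic P.L₁ P.L₂ P.Jc
  Je_periodic : IsPeriodic P.L₁ P.L₂ P.Je
  Jc_nonneg : ∀ x, 0 ≤ P.Jc x
  Je_nonneg : ∀ x, 0 ≤ P.Je x
  Jc_even : ∀ x, P.Jc (-x) = P.Jc x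
  Je_even : ∀ x, P.Je (-x) = P.Je x
  mass_pos : 0 < P.mass P.J
  γc_nonneg : 0 ≤ P.γc
  γe_nonneg : 0 ≤ P.γe
  diffusivity_pos : 0 < P.γc - P.γe + P.mass P.J

/-- `Φ` (with `Φ t x` its value at time `t` and position `x`) is a smooth (up to `t = 0` and
`t = T`), `Ω`-periodic solution of the nonlocal Cahn--Hilliard equation `∂ₜ Φ = Δ w(Φ)` for
`0 < t ≤ T`. The time derivative is one-sided at `t = T`. -/
structure IsSmoothSolution (T : ℝ) (Φ : ℝ → Plane → ℝ) : Prop where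
  smooth : ContDiffOn ℝ ∞ (fun p : ℝ × Plane => Φ p.1 p.2) (Icc 0 T ×ˢ univ)
  periodic : ∀ t ∈ Icc 0 T, IsPeriodic P.L₁ P.L₂ (Φ t)
  equation : ∀ t ∈ Ioc 0 T, ∀ x : Plane,
    derivWithin (fun τ => Φ τ x) (Icc 0 T) t = Laplacian.laplacian (P.chemicalPotential (Φ t)) x

end Model

/-! ### The grid -/

/-- Grid functions, extended to the infinite grid. A cell-centered function `φ` has
`φ i j = φ_{i,j}`; a vertex-centered function `f` has `f i j = f_{i+1/2,j+1/2}`. -/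
abbrev GridFun : Type := ℤ → ℤ → ℝ

/-- `(m, n, h)` is a uniform grid on `(0, L₁) × (0, L₂)`: `L₁ = m h` and `L₂ = n h`. -/
structure IsGrid (L₁ L₂ : ℝ) (m n : ℕ) (h : ℝ) : Prop where
  m_pos : 0 < m
  n_pos : 0 < n
  h_pos : 0 < h
  L₁_eq : L₁ = m * h
  L₂_eq : L₂ = n * h

/-- The grid coordinate `p_r = (r - 1/2) h`. -/
def gridPt (h r : ℝ) : ℝ := (r - 1 / 2) * h

/-- Restriction of a function to the cell centers, `φ_{i,j} = f(p_i, p_j)`. -/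
def cellRestrict (h : ℝ) (f : Plane → ℝ) : GridFun :=
  fun i j => f !₂[gridPt h i, gridPt h j]

/-- Restriction to the vertices, `f_{i+1/2,j+1/2} = f(p_{i+1/2}, p_{j+1/2})`. -/
def vertexRestrict (h : ℝ) (f : Plane → ℝ) : GridFun :=
  fun i j => f !₂[gridPt h (i + 1 / 2), gridPt h (j + 1 / 2)]

/-- Periodicity of a grid function: `φ_{i + p m, j + q n} = φ_{i,j}`. -/
def IsGridPeriodic (m n : ℕ) (φ : GridFun) : Prop :=
  ∀ i j p q : ℤ, φ (i + p * m) (j + q * n) = φ i j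

/-- The discrete convolution
`(f ⋆ φ)_{i,j} = h² ∑_{k=1}^m ∑_{l=1}^n f_{k+1/2,l+1/2} φ_{i-k,j-l}`
of a vertex-centered `f` with a cell-centered `φ`. -/
def gridConv (m n : ℕ) (h : ℝ) (f φ : GridFun) : GridFun := fun i j =>
  h ^ 2 * ∑ k ∈ Finset.Icc (1 : ℤ) m, ∑ l ∈ Finset.Icc (1 : ℤ) n, f k l * φ (i - k) (j - l)

/-- The constant value of `f ⋆ 1`. -/
def gridMass (m n : ℕ) (h : ℝ) (f : GridFun) : ℝ :=
  h ^ 2 * ∑ k ∈ Finset.Icc (1 : ℤ) m, ∑ l ∈ Finset.Icc (1 : ℤ) n, f k l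

theorem gridConv_one (m n : ℕ) (h : ℝ) (f : GridFun) (i j : ℤ) :
    gridConv m n h f (fun _ _ => 1) i j = gridMass m n h f := by
  simp [gridConv, gridMass]

/-- The standard five-point discrete Laplacian. -/
def gridLaplacian (h : ℝ) (φ : GridFun) : GridFun := fun i j =>
  (φ (i + 1) j + φ (i - 1) j + φ i (j + 1) + φ i (j - 1) - 4 * φ i j) / h ^ 2

/-- The discrete norm `‖φ‖₂ = (h² ∑_{i=1}^m ∑_{j=1}^n φ_{i,j}²)^{1/2}`. -/
def gridNorm (m n : ℕ) (h : ℝ) (φ : GridFun) : ℝ :=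
  Real.sqrt (h ^ 2 * ∑ i ∈ Finset.Icc (1 : ℤ) m, ∑ j ∈ Finset.Icc (1 : ℤ) n, φ i j ^ 2)

/-! ### The fully discrete scheme -/

/-- `η(a, b) = (a² + b²)(a + b) / 4`. -/
def eta (a b : ℝ) : ℝ := 1 / 4 * (a ^ 2 + b ^ 2) * (a + b)

/-- The previous time level of a sequence of grid functions, with the convention `φ^{-1} = φ^0`. -/
def prevLevel (φ : ℕ → GridFun) : ℕ → GridFun
  | 0 => φ 0
  | k + 1 => φ k

/-- The average `φ^{k+1/2} = (φ^k + φ^{k+1}) / 2`. -/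
def midLevel (φ : ℕ → GridFun) (k : ℕ) : GridFun := fun i j =>
  1 / 2 * (φ k i j + φ (k + 1) i j)

/-- The extrapolation `\hat φ^{k+1/2} = (3/2) φ^k - (1/2) φ^{k-1}`. -/
def extrapLevel (φ : ℕ → GridFun) (k : ℕ) : GridFun := fun i j =>
  3 / 2 * φ k i j - 1 / 2 * prevLevel φ k i j

namespace Model

variable (P : Model)

/-- `B_c = J_c ⋆ 1 + γ_c` on the grid `(m, n, h)`. -/
def Bc (m n : ℕ) (h : ℝ) : ℝ := gridMass m n h (vertexRestrict h P.Jc) + P.γc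

/-- `B_e = J_e ⋆ 1 + γ_e` on the grid `(m, n, h)`. -/
def Be (m n : ℕ) (h : ℝ) : ℝ := gridMass m n h (vertexRestrict h P.Je) + P.γe

/-- The discrete chemical potential
`w^{k+1/2} = η(φ^k, φ^{k+1}) + B_c φ^{k+1/2} - B_e \hat φ^{k+1/2} - J ⋆ \hat φ^{k+1/2}`. -/
def discretePotential (m n : ℕ) (h : ℝ) (φ : ℕ → GridFun) (k : ℕ) : GridFun := fun i j =>
  eta (φ k i j) (φ (k + 1) i j) + P.Bc m n h * midLevel φ k i j
    - P.Be m n h * extrapLevel φ k i j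
    - gridConv m n h (vertexRestrict h P.J) (extrapLevel φ k) i j

/-- `φ^0, φ^1, …` is, up to time `T`, a periodic solution of the second order convex splitting
scheme with time step `s` on the grid `(m, n, h)`, started from the cell-centered restriction of
`Φ₀`. -/
structure IsSchemeSolution (m n : ℕ) (h s T : ℝ) (Φ₀ : Plane → ℝ) (φ : ℕ → GridFun) : Prop where
  initial : φ 0 = cellRestrict h Φ₀
  periodic : ∀ k : ℕ, (k : ℝ) * s ≤ T → IsGridPeriodic m n (φ k)
  step : ∀ k : ℕ, ((k + 1 : ℕ) : ℝ) * s ≤ T → ∀ i j : ℤ,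
    φ (k + 1) i j - φ k i j = s * gridLaplacian h (P.discretePotential m n h φ k) i j

end Model

end NonlocalCH

end

noncomputable section

namespace NonlocalCH

/-! ### Sums over one period of the grid -/

/-! The proof is consistency plus stability, with stability measured in a relative energy rather
than in the squared error. The function η is the discrete gradient of F(x) = x⁴/4: η(a, b)(b − a) =
F(b) − F(a). Hence, if the error equation is tested with the local part u of the error of the
chemical potential (cubic term, B_c term and B_e term, without the convolution), the left side is
the increment of F(Φ + ε) − F(Φ) − F'(Φ)ε plus quadratic terms, up to a remainder multiplied by the
time increment of Φ, which is O(s). This is `relQuartic_sub` and `energyDensity_step`.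

On the right side stands ⟨Δ_h(u − v), u⟩, where v is J ⋆ the extrapolated error. Summation by parts
gives −|∇u|² + ⟨∇u, ∇v⟩ ≤ |∇v|²/4, and the differences in ∇v fall on the smooth kernel, so only the
L² norm of the error is needed (`gridSum_laplacian_sub_mul_le`, `gridSum_grad_gridConv_le`). The
relative energy controls both the L² norm, through B_c − B_e ≥ α, and the L⁴ norm, through convexity
of x⁴ (`energyDensity_bound`). All nonlinear remainders are of degree two to four in the errors, so
the energy absorbs them and no maximum bound on the numerical solution is needed. A discrete
Gronwall argument then closes the estimate in `scheme_stability`.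

In the first step the convention φ⁻¹ = φ⁰ makes the extrapolation only first order. The initial
error vanishes, however, so this step produces an energy of order (s · (h² + s))², which is still
O((h² + s²)²) (`gridSum_energyDensity_first_step`).

Consistency (`exists_residual_bound`, `exists_consistency`) expands about the half time t + s/2.
Three ingredients are of second order: time averages and extrapolations, with spatial second
differences controlled uniformly in h; the five-point Laplacian; and the rectangle rule for periodic
integrands, which turns the discrete convolution into the integral. -/

theorem sum_Icc_add_one_of_periodic {m : ℕ} {g : ℤ → ℝ} (hg : ∀ i, g (i + m) = g i) :
    ∑ i ∈ Finset.Icc (1 : ℤ) m, g (i + 1) = ∑ i ∈ Finset.Icc (1 : ℤ) m, g i := by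
  rcases Nat.eq_zero_or_pos m with rfl | hm
  · simp
  have e1 : ∑ i ∈ Finset.Icc (1 : ℤ) m, g (i + 1) = ∑ i ∈ Finset.Icc (2 : ℤ) (m + 1), g i := by
    refine Finset.sum_bij (fun i _ => i + 1) ?_ ?_ ?_ ?_
    · intro i hi; simp only [Finset.mem_Icc] at *; omega
    · intro i _ j _ h; simpa using h
    · intro j hj; refine ⟨j - 1, ?_, by ring⟩; simp only [Finset.mem_Icc] at *; omega
    · intros; rfl
  have e2 : Finset.Icc (2 : ℤ) (m + 1) = insert ((m : ℤ) + 1) (Finset.Icc (2 : ℤ) m) := by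
    ext i; simp only [Finset.mem_Icc, Finset.mem_insert]; omega
  have e3 : Finset.Icc (1 : ℤ) m = insert (1 : ℤ) (Finset.Icc (2 : ℤ) m) := by
    ext i; simp only [Finset.mem_Icc, Finset.mem_insert]; omega
  rw [e1, e2, e3, Finset.sum_insert (by simp), Finset.sum_insert (by simp), add_comm (m : ℤ) 1, hg]

theorem sum_Icc_add_of_periodic {m : ℕ} {g : ℤ → ℝ} (hg : ∀ i, g (i + m) = g i) (c : ℤ) :
    ∑ i ∈ Finset.Icc (1 : ℤ) m, g (i + c) = ∑ i ∈ Finset.Icc (1 : ℤ) m, g i := by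
  have step : ∀ c : ℤ, ∑ i ∈ Finset.Icc (1 : ℤ) m, g (i + (c + 1))
      = ∑ i ∈ Finset.Icc (1 : ℤ) m, g (i + c) := by
    intro c
    have := sum_Icc_add_one_of_periodic (m := m) (g := fun i => g (i + c))
      (fun i => by rw [← hg (i + c)]; congr 1; ring)
    rw [← this]
    refine Finset.sum_congr rfl fun i _ => ?_
    congr 1; ring
  induction c using Int.induction_on with
  | zero => simp
  | succ i ih => rw [step, ih]
  | pred i ih => rw [← step, sub_add_cancel, ih]

theorem sum_Icc_sub_of_periodic {m : ℕ} {g : ℤ → ℝ} (hg : ∀ i, g (i + m) = g i) (c : ℤ) :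
    ∑ i ∈ Finset.Icc (1 : ℤ) m, g (c - i) = ∑ i ∈ Finset.Icc (1 : ℤ) m, g i := by
  -- The reflection i ↦ m + 1 − i maps {1, …, m} to itself, and c − i = (m + 1 − i) + (c − 1 − m).
  rw [← sum_Icc_add_of_periodic hg (c - 1 - m)]
  refine Finset.sum_bij (fun i _ => m + 1 - i) ?_ ?_ ?_ ?_
  · intro i hi; simp only [Finset.mem_Icc] at *; omega
  · intro i _ j _ h; simpa using h
  · intro j hj; refine ⟨m + 1 - j, ?_, by ring⟩; simp only [Finset.mem_Icc] at *; omega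
  · intro i _; congr 1; ring

/-- The discrete integral `h² ∑_{i=1}^m ∑_{j=1}^n f_{i,j}`. -/
def gridSum (m n : ℕ) (h : ℝ) (f : GridFun) : ℝ :=
  h ^ 2 * ∑ i ∈ Finset.Icc (1 : ℤ) m, ∑ j ∈ Finset.Icc (1 : ℤ) n, f i j

section GridSum

variable {m n : ℕ} {h : ℝ}

theorem gridSum_add (f g : GridFun) :
    gridSum m n h (fun i j => f i j + g i j) = gridSum m n h f + gridSum m n h g := by
  simp only [gridSum, Finset.sum_add_distrib, mul_add]

theorem gridSum_sub (f g : GridFun) :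
    gridSum m n h (fun i j => f i j - g i j) = gridSum m n h f - gridSum m n h g := by
  simp only [gridSum, Finset.sum_sub_distrib, mul_sub]

theorem gridSum_smul (c : ℝ) (f : GridFun) :
    gridSum m n h (fun i j => c * f i j) = c * gridSum m n h f := by
  simp only [gridSum, ← Finset.mul_sum]; ring

theorem gridSum_mono {f g : GridFun} (hfg : ∀ i j, f i j ≤ g i j) :
    gridSum m n h f ≤ gridSum m n h g :=
  mul_le_mul_of_nonneg_left
    (Finset.sum_le_sum fun i _ => Finset.sum_le_sum fun j _ => hfg i j) (sq_nonneg h)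

theorem gridSum_nonneg {f : GridFun} (hf : ∀ i j, 0 ≤ f i j) : 0 ≤ gridSum m n h f :=
  mul_nonneg (sq_nonneg h) (Finset.sum_nonneg fun i _ => Finset.sum_nonneg fun j _ => hf i j)

theorem abs_gridSum_le (f : GridFun) : |gridSum m n h f| ≤ gridSum m n h (fun i j => |f i j|) := by
  rw [abs_le]
  constructor
  · have := gridSum_mono (m := m) (n := n) (h := h) (f := fun i j => (-1) * |f i j|) (g := f)
      (fun i j => by linarith [neg_abs_le (f i j)])
    rw [gridSum_smul] at this
    linarith
  · exact gridSum_mono fun i j => le_abs_self _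

theorem gridSum_const {L₁ L₂ : ℝ} (hg : IsGrid L₁ L₂ m n h) (c : ℝ) :
    gridSum m n h (fun _ _ => c) = L₁ * L₂ * c := by
  simp only [gridSum, Finset.sum_const, Int.card_Icc, hg.L₁_eq, hg.L₂_eq, nsmul_eq_mul]
  simp
  ring

theorem IsGridPeriodic.add_left {f : GridFun} (hf : IsGridPeriodic m n f) (i j : ℤ) :
    f (i + m) j = f i j := by simpa using hf i j 1 0

theorem IsGridPeriodic.add_right {f : GridFun} (hf : IsGridPeriodic m n f) (i j : ℤ) :
    f i (j + n) = f i j := by simpa using hf i j 0 1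

theorem gridSum_add_shift {f : GridFun} (hf : IsGridPeriodic m n f) (a b : ℤ) :
    gridSum m n h (fun i j => f (i + a) (j + b)) = gridSum m n h f := by
  unfold gridSum
  congr 1
  rw [← sum_Icc_add_of_periodic (m := m)
    (g := fun i => ∑ j ∈ Finset.Icc (1 : ℤ) n, f i j) (fun i => by simp only [hf.add_left]) a]
  exact Finset.sum_congr rfl fun i _ => sum_Icc_add_of_periodic (fun j => hf.add_right _ j) b

theorem gridSum_reflect {f : GridFun} (hf : IsGridPeriodic m n f) (a b : ℤ) :
    gridSum m n h (fun i j => f (a - i) (b - j)) = gridSum m n h f := by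
  unfold gridSum
  congr 1
  rw [← sum_Icc_sub_of_periodic (m := m)
    (g := fun i => ∑ j ∈ Finset.Icc (1 : ℤ) n, f i j) (fun i => by simp only [hf.add_left]) a]
  exact Finset.sum_congr rfl fun i _ => sum_Icc_sub_of_periodic (fun j => hf.add_right _ j) b

theorem gridSum_mul_sq_le (f g : GridFun) :
    gridSum m n h (fun i j => f i j * g i j) ^ 2
      ≤ gridSum m n h (fun i j => f i j ^ 2) * gridSum m n h (fun i j => g i j ^ 2) := by
  have := Finset.sum_mul_sq_le_sq_mul_sq
    (Finset.Icc (1 : ℤ) m ×ˢ Finset.Icc (1 : ℤ) n) (fun p => f p.1 p.2) (fun p => g p.1 p.2)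
  simp only [Finset.sum_product] at this
  unfold gridSum
  calc _ = (h ^ 2) ^ 2 * (∑ i ∈ Finset.Icc (1 : ℤ) m, ∑ j ∈ Finset.Icc (1 : ℤ) n,
        f i j * g i j) ^ 2 := by ring
    _ ≤ (h ^ 2) ^ 2 * _ := mul_le_mul_of_nonneg_left this (sq_nonneg _)
    _ = _ := by ring

/-- Summation by parts, with the cross term absorbed by Young's inequality. -/
theorem gridSum_laplacian_sub_mul_le {u v : GridFun} (hu : IsGridPeriodic m n u)
    (hv : IsGridPeriodic m n v) (hh : 0 < h) :
    gridSum m n h (fun i j => gridLaplacian h (fun i j => u i j - v i j) i j * u i j)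
      ≤ 1 / 4 * gridSum m n h (fun i j =>
        ((v (i + 1) j - v i j) / h) ^ 2 + ((v i (j + 1) - v i j) / h) ^ 2) := by
  set w : GridFun := fun i j => u i j - v i j with hw
  have hwp : IsGridPeriodic m n w := fun i j p q => by simp only [hw, hu i j p q, hv i j p q]
  have s1 : gridSum m n h (fun i j => (w (i + 1) j - w i j) * u (i + 1) j / h ^ 2)
      = gridSum m n h (fun i j => (w i j - w (i - 1) j) * u i j / h ^ 2) := by
    rw [← gridSum_add_shift (f := fun i j => (w i j - w (i - 1) j) * u i j / h ^ 2) _ 1 0]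
    · simp
    · intro i j p q
      simp only [hwp i j p q, hu i j p q, show i + p * m - 1 = i - 1 + p * m by ring,
        hwp (i - 1) j p q]
  have s2 : gridSum m n h (fun i j => (w i (j + 1) - w i j) * u i (j + 1) / h ^ 2)
      = gridSum m n h (fun i j => (w i j - w i (j - 1)) * u i j / h ^ 2) := by
    rw [← gridSum_add_shift (f := fun i j => (w i j - w i (j - 1)) * u i j / h ^ 2) _ 0 1]
    · simp
    · intro i j p q
      simp only [hwp i j p q, hu i j p q, show j + q * n - 1 = j - 1 + q * n by ring,
        hwp i (j - 1) p q]
  have e : gridSum m n h (fun i j => gridLaplacian h w i j * u i j)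
      = gridSum m n h (fun i j => (w (i + 1) j - w i j) * u i j / h ^ 2
          - (w (i + 1) j - w i j) * u (i + 1) j / h ^ 2
          + ((w i (j + 1) - w i j) * u i j / h ^ 2
          - (w i (j + 1) - w i j) * u i (j + 1) / h ^ 2)) := by
    rw [gridSum_add, gridSum_sub, gridSum_sub, s1, s2, ← gridSum_sub, ← gridSum_sub, ← gridSum_add]
    congr 1
    funext i j
    simp only [gridLaplacian]
    ring
  rw [e, ← gridSum_smul]
  refine gridSum_mono fun i j => ?_
  -- With X = x/h and Y = y/h this is −(X − Y)X = Y²/4 − (X − Y/2)². The dissipation of u absorbs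
  -- the whole cross term.
  have key : ∀ x y : ℝ, (x / h - y / h) * (x / h) * (-1) ≤ 1 / 4 * (y / h) ^ 2 := fun x y => by
    nlinarith [sq_nonneg (x / h - 1 / 2 * (y / h))]
  have k1 := key (u (i + 1) j - u i j) (v (i + 1) j - v i j)
  have k2 := key (u i (j + 1) - u i j) (v i (j + 1) - v i j)
  have : ∀ a b c d : ℝ, ((a - b) - (c - d)) * c / h ^ 2 - ((a - b) - (c - d)) * a / h ^ 2
      = ((a - c) / h - (b - d) / h) * ((a - c) / h) * (-1) := by
    intro a b c d; field_simp; ring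
  simp only [hw]
  rw [this, this]
  linarith

end GridSum

/-! ### The discrete convolution -/

section GridConv

variable {m n : ℕ} {h : ℝ}

theorem gridConv_eq_gridSum (f φ : GridFun) (i j : ℤ) :
    gridConv m n h f φ i j = gridSum m n h (fun k l => f k l * φ (i - k) (j - l)) := rfl

theorem gridConv_periodic (f : GridFun) {φ : GridFun} (hφ : IsGridPeriodic m n φ) :
    IsGridPeriodic m n (gridConv m n h f φ) := by
  intro i j p q
  simp only [gridConv_eq_gridSum]
  congr 1
  funext k l
  rw [← hφ (i - k) (j - l) p q]
  congr 2 <;> ring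

theorem gridConv_sub (f φ ψ : GridFun) (i j : ℤ) :
    gridConv m n h f (fun i j => φ i j - ψ i j) i j
      = gridConv m n h f φ i j - gridConv m n h f ψ i j := by
  simp only [gridConv_eq_gridSum, mul_sub, gridSum_sub]

/-- Translating the summation index moves a shift of the output onto the kernel. Difference
quotients of a convolution therefore cost regularity of the kernel only. -/
theorem gridConv_shift {f φ : GridFun} (hf : IsGridPeriodic m n f) (hφ : IsGridPeriodic m n φ)
    (a b i j : ℤ) :
    gridConv m n h f φ (i + a) (j + b) = gridConv m n h (fun k l => f (k + a) (l + b)) φ i j := by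
  simp only [gridConv_eq_gridSum]
  rw [← gridSum_add_shift (f := fun k l => f k l * φ (i + a - k) (j + b - l)) _ a b]
  · simp only [add_sub_add_right_eq_sub]
  · intro k l p q
    have h1 : i + a - k = i + a - (k + p * m) + p * m := by ring
    have h2 : j + b - l = j + b - (l + q * n) + q * n := by ring
    simp only [hf k l p q]
    rw [h1, h2, hφ]

theorem gridConv_sq_le {f φ : GridFun} {L₁ L₂ K : ℝ} (hg : IsGrid L₁ L₂ m n h)
    (hφ : IsGridPeriodic m n φ) (hf : ∀ k l, |f k l| ≤ K) (i j : ℤ) :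
    gridConv m n h f φ i j ^ 2
      ≤ L₁ * L₂ * K ^ 2 * gridSum m n h (fun i j => φ i j ^ 2) := by
  rw [gridConv_eq_gridSum]
  refine (gridSum_mul_sq_le _ _).trans ?_
  have hp : IsGridPeriodic m n (fun i j => φ i j ^ 2) := fun i j p q => by simp only [hφ i j p q]
  rw [gridSum_reflect hp i j]
  refine mul_le_mul_of_nonneg_right ?_ (gridSum_nonneg fun _ _ => sq_nonneg _)
  rw [← gridSum_const hg]
  exact gridSum_mono fun k l => sq_le_sq' (by linarith [neg_abs_le (f k l), hf k l])
    ((le_abs_self _).trans (hf k l))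

/-- The differences fall on the kernel, where they are O(h), and Cauchy–Schwarz bounds each value by
the L² norm of `φ`. The bound involves no differences of `φ`, which makes the nonlocal term a
lower-order perturbation. -/
theorem gridSum_grad_gridConv_le {f φ : GridFun} {L₁ L₂ K : ℝ} (hg : IsGrid L₁ L₂ m n h)
    (hf : IsGridPeriodic m n f) (hφ : IsGridPeriodic m n φ)
    (hf₁ : ∀ k l, |f (k + 1) l - f k l| ≤ K * h) (hf₂ : ∀ k l, |f k (l + 1) - f k l| ≤ K * h) :
    gridSum m n h (fun i j =>
        ((gridConv m n h f φ (i + 1) j - gridConv m n h f φ i j) / h) ^ 2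
          + ((gridConv m n h f φ i (j + 1) - gridConv m n h f φ i j) / h) ^ 2)
      ≤ 2 * (L₁ * L₂ * K) ^ 2 * gridSum m n h (fun i j => φ i j ^ 2) := by
  have hh := hg.h_pos
  have e : ∀ (f₁ f₂ : GridFun) (i j : ℤ), gridConv m n h f₁ φ i j - gridConv m n h f₂ φ i j
      = gridConv m n h (fun k l => f₁ k l - f₂ k l) φ i j := by
    intro f₁ f₂ i j
    simp only [gridConv_eq_gridSum, sub_mul, gridSum_sub]
  have b : ∀ (g : GridFun) (i j : ℤ), (∀ k l, |g k l| ≤ K * h) →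
      (gridConv m n h g φ i j / h) ^ 2
        ≤ L₁ * L₂ * K ^ 2 * gridSum m n h (fun i j => φ i j ^ 2) := by
    intro g i j hgK
    rw [div_pow, div_le_iff₀ (by positivity)]
    refine (gridConv_sq_le hg hφ hgK i j).trans (le_of_eq (by ring))
  have hb : ∀ i j, ((gridConv m n h f φ (i + 1) j - gridConv m n h f φ i j) / h) ^ 2
          + ((gridConv m n h f φ i (j + 1) - gridConv m n h f φ i j) / h) ^ 2
      ≤ 2 * (L₁ * L₂ * K ^ 2 * gridSum m n h (fun i j => φ i j ^ 2)) := by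
    intro i j
    have h1 := gridConv_shift (h := h) hf hφ 1 0 i j
    have h2 := gridConv_shift (h := h) hf hφ 0 1 i j
    simp only [add_zero] at h1 h2
    rw [h1, h2, e, e]
    linarith [b _ i j hf₁, b _ i j hf₂]
  refine (gridSum_mono hb).trans (le_of_eq ?_)
  rw [gridSum_const hg]
  ring

end GridConv

/-! ### Stability of the scheme -/

/-- The relative energy density `F(x + ε) - F(x) - F'(x) ε` of `F(x) = x⁴ / 4`. -/
def relQuartic (x ε : ℝ) : ℝ := (ε ^ 4 + 4 * x * ε ^ 3 + 6 * x ^ 2 * ε ^ 2) / 4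

/-- The difference of the two sides is (3/2) ε² (x + ε/3)², so the quartic coercivity is uniform in
the base point `x`. -/
theorem pow_four_le_relQuartic (x ε : ℝ) : ε ^ 4 / 12 ≤ relQuartic x ε := by
  have : 0 ≤ ε ^ 2 * (x + ε / 3) ^ 2 := by positivity
  unfold relQuartic
  nlinarith

/-- The part of `η(a + p, b + q) - η(a, b)` of degree at least two in `(p, q)`. -/
def etaRem (a b p q : ℝ) : ℝ :=
  ((3 * a + b) * p ^ 2 + 2 * (a + b) * p * q + (a + 3 * b) * q ^ 2) / 4 + eta p q

theorem eta_sub_eta (a b p q : ℝ) :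
    eta (a + p) (b + q) - eta a b
      = ((3 * a ^ 2 + 2 * a * b + b ^ 2) * p + (a ^ 2 + 2 * a * b + 3 * b ^ 2) * q) / 4
        + etaRem a b p q := by
  unfold etaRem eta; ring

/-- This is the discrete chain rule for x⁴/4, applied to the perturbed and to the exact values and
subtracted. The linear part of η in `eta_sub_eta` cancels against the increment of F'(Φ)ε, so the
defect is at least quadratic in the errors and carries the small factor `b - a`. -/
theorem relQuartic_sub (a b p q : ℝ) :
    relQuartic b q - relQuartic a p
      = (eta (a + p) (b + q) - eta a b) * (q - p) + etaRem a b p q * (b - a) := by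
  unfold relQuartic etaRem eta; ring

theorem eta_neg (p q : ℝ) : eta (-p) (-q) = -eta p q := by unfold eta; ring

theorem abs_etaRem_le {M a b : ℝ} (hM : 1 ≤ M) (ha : |a| ≤ M) (hb : |b| ≤ M) (p q : ℝ) :
    |etaRem a b p q| ≤ 2 * M * (p ^ 2 + q ^ 2 + p ^ 4 + q ^ 4) := by
  have main : ∀ a b p q : ℝ, |a| ≤ M → |b| ≤ M →
      etaRem a b p q ≤ 2 * M * (p ^ 2 + q ^ 2 + p ^ 4 + q ^ 4) := by
    intro a b p q ha hb
    rw [abs_le] at ha hb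
    have h1 : (3 * a + b) * p ^ 2 ≤ 4 * M * p ^ 2 :=
      mul_le_mul_of_nonneg_right (by linarith) (sq_nonneg _)
    have h2 : (a + 3 * b) * q ^ 2 ≤ 4 * M * q ^ 2 :=
      mul_le_mul_of_nonneg_right (by linarith) (sq_nonneg _)
    have h3 : 2 * (a + b) * p * q ≤ 2 * M * (p ^ 2 + q ^ 2) := by
      have e1 := mul_nonneg (show 0 ≤ 2 * M - (a + b) by linarith) (sq_nonneg (p + q))
      have e2 := mul_nonneg (show 0 ≤ 2 * M + (a + b) by linarith) (sq_nonneg (p - q))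
      linarith
    have h4 : eta p q ≤ 1 / 4 * (p ^ 2 + q ^ 2 + p ^ 4 + q ^ 4) := by
      have e1 : p + q ≤ 1 + (p ^ 2 + q ^ 2) / 2 := by nlinarith [sq_nonneg (p - 1), sq_nonneg (q - 1)]
      have e2 := mul_le_mul_of_nonneg_left e1 (show 0 ≤ p ^ 2 + q ^ 2 by positivity)
      unfold eta
      nlinarith [sq_nonneg (p ^ 2 - q ^ 2)]
    have h5 : 0 ≤ p ^ 4 + q ^ 4 := by positivity
    have h6 : 0 ≤ p ^ 2 + q ^ 2 := by positivity
    unfold etaRem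
    nlinarith
  rw [abs_le]
  constructor
  -- The remainder is odd under a simultaneous change of sign, so the upper bound yields the lower
  -- bound.
  · have h := main (-a) (-b) (-p) (-q) (by rwa [abs_neg]) (by rwa [abs_neg])
    have e : etaRem (-a) (-b) (-p) (-q) = -etaRem a b p q := by
      unfold etaRem; rw [eta_neg]; ring
    rw [e] at h
    have : 2 * M * ((-p) ^ 2 + (-q) ^ 2 + (-p) ^ 4 + (-q) ^ 4)
        = 2 * M * (p ^ 2 + q ^ 2 + p ^ 4 + q ^ 4) := by ring
    linarith
  · exact main a b p q ha hb

/-- The error of the local part of the discrete chemical potential. -/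
def localError (bc be a b o p q : ℝ) : ℝ :=
  eta (a + p) (b + q) - eta a b + bc * (1 / 2 * (p + q)) - be * (3 / 2 * p - 1 / 2 * o)

/-- Needed only to pair the test function with the truncation error. Linear and higher-order parts
stay separate because the linear part must still be weighted by the small truncation error, while
the rest goes directly into the energy. -/
theorem abs_localError_le {M bc be a b : ℝ} (hM : 1 ≤ M) (hbe : 0 ≤ be) (hbc : be ≤ bc)
    (hbM : bc ≤ M) (ha : |a| ≤ M) (hb : |b| ≤ M) (o p q : ℝ) :
    |localError bc be a b o p q| ≤ 4 * M ^ 2 * (|p| + |q| + |o|)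
      + 2 * M * (p ^ 2 + q ^ 2 + p ^ 4 + q ^ 4) := by
  have hQ := abs_etaRem_le hM ha hb p q
  have hMM : M ≤ M ^ 2 := by nlinarith
  have haa : |a ^ 2| ≤ M ^ 2 := by rw [abs_pow]; exact pow_le_pow_left₀ (abs_nonneg _) ha 2
  have hbb : |b ^ 2| ≤ M ^ 2 := by rw [abs_pow]; exact pow_le_pow_left₀ (abs_nonneg _) hb 2
  have hab : |a * b| ≤ M ^ 2 := by
    rw [abs_mul, sq]; exact mul_le_mul ha hb (abs_nonneg _) (by linarith)
  rw [abs_le] at haa hbb hab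
  have mulb : ∀ c B x : ℝ, |c| ≤ B → |c * x| ≤ B * |x| := fun c B x h => by
    rw [abs_mul]; exact mul_le_mul_of_nonneg_right h (abs_nonneg _)
  have l1 := mulb (3 * a ^ 2 + 2 * a * b + b ^ 2) (6 * M ^ 2) p
    (by rw [abs_le]; constructor <;> linarith)
  have l2 := mulb (a ^ 2 + 2 * a * b + 3 * b ^ 2) (6 * M ^ 2) q
    (by rw [abs_le]; constructor <;> linarith)
  have l3 := mulb bc (M ^ 2) p (by rw [abs_le]; constructor <;> linarith)
  have l4 := mulb bc (M ^ 2) q (by rw [abs_le]; constructor <;> linarith)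
  have l5 := mulb be (M ^ 2) p (by rw [abs_le]; constructor <;> linarith)
  have l6 := mulb be (M ^ 2) o (by rw [abs_le]; constructor <;> linarith)
  have n1 := mul_nonneg (sq_nonneg M) (abs_nonneg p)
  have n2 := mul_nonneg (sq_nonneg M) (abs_nonneg q)
  have n3 := mul_nonneg (sq_nonneg M) (abs_nonneg o)
  unfold localError
  rw [eta_sub_eta]
  rw [abs_le] at *
  constructor <;> linarith [l1.1, l1.2, l2.1, l2.2, l3.1, l3.2, l4.1, l4.2, l5.1, l5.2, l6.1, l6.2]

/-- The modified relative energy density at an exact value `x`, for the errors `ε` and `o` at the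
present and the previous time level. -/
def energyDensity (bc be x ε o : ℝ) : ℝ :=
  relQuartic x ε + (bc - be) / 2 * ε ^ 2 + be / 4 * (ε - o) ^ 2

/-- The extrapolation is the average minus half a second difference: 3p/2 − o/2 = (p + q)/2 − ((q −
p) − (p − o))/2. Tested with q − p, the average reduces `bc` to `bc - be`. The second difference, by
2(x − y)x = x² − y² + (x − y)², gives the increment of be/4 · (ε − o)², which explains that term of
the density, and a nonnegative square that is dropped. -/
theorem energyDensity_step {bc be : ℝ} (hbe : 0 ≤ be) (a b o p q : ℝ) :
    energyDensity bc be b q p ≤ energyDensity bc be a p o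
      + (q - p) * localError bc be a b o p q + |etaRem a b p q| * |b - a| := by
  have h1 : etaRem a b p q * (b - a) ≤ |etaRem a b p q| * |b - a| := by
    rw [← abs_mul]; exact le_abs_self _
  have h2 := relQuartic_sub a b p q
  have h3 := mul_nonneg hbe (sq_nonneg ((q - p) - (p - o)))
  unfold energyDensity localError
  nlinarith

theorem energyDensity_bound {α bc be : ℝ} (hα : 0 < α) (hbe : 0 ≤ be) (hb : α ≤ bc - be)
    (x ε o : ℝ) : ε ^ 2 ≤ 2 / α * energyDensity bc be x ε o
      ∧ ε ^ 4 ≤ 12 * energyDensity bc be x ε o := by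
  have h1 := pow_four_le_relQuartic x ε
  have h2 : 0 ≤ be / 4 * (ε - o) ^ 2 := by positivity
  have h3 : α / 2 * ε ^ 2 ≤ (bc - be) / 2 * ε ^ 2 :=
    mul_le_mul_of_nonneg_right (by linarith) (sq_nonneg _)
  have h4 : 0 ≤ α / 2 * ε ^ 2 := by positivity
  have h5 : 0 ≤ ε ^ 4 := by positivity
  unfold energyDensity
  constructor
  · have h : α / 2 * ε ^ 2 ≤ relQuartic x ε + (bc - be) / 2 * ε ^ 2 + be / 4 * (ε - o) ^ 2 := by
      linarith
    calc ε ^ 2 = 2 / α * (α / 2 * ε ^ 2) := by field_simp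
      _ ≤ _ := mul_le_mul_of_nonneg_left h (by positivity)
  · linarith

/-! ### One time step of the error equation in the relative energy. -/

section Step

variable {m n : ℕ} {h s L₁ L₂ M α bc be σ : ℝ} {J a b o p q τ : GridFun}

/-- One step of the error equation, tested with the local part of the potential. -/
theorem gridSum_energyDensity_step (hg : IsGrid L₁ L₂ m n h) (hs : 0 < s) (hM : 1 ≤ M)
    (hbe : 0 ≤ be) (hbc : be ≤ bc) (hbM : bc ≤ M)
    (hJ : IsGridPeriodic m n J) (hJ₁ : ∀ k l, |J (k + 1) l - J k l| ≤ M * h)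
    (hJ₂ : ∀ k l, |J k (l + 1) - J k l| ≤ M * h)
    (ha : ∀ i j, |a i j| ≤ M) (hb : ∀ i j, |b i j| ≤ M) (hab : ∀ i j, |b i j - a i j| ≤ M * s)
    (hap : IsGridPeriodic m n a) (hbp : IsGridPeriodic m n b) (hop : IsGridPeriodic m n o)
    (hpp : IsGridPeriodic m n p) (hqp : IsGridPeriodic m n q)
    (hτ : ∀ i j, |τ i j| ≤ σ) (hσ : σ ≤ 2 * M)
    (heq : ∀ i j, q i j - p i j = s * gridLaplacian h (fun i j =>
      localError bc be (a i j) (b i j) (o i j) (p i j) (q i j)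
        - gridConv m n h J (fun i j => 3 / 2 * p i j - 1 / 2 * o i j) i j) i j - s * τ i j) :
    gridSum m n h (fun i j => energyDensity bc be (b i j) (q i j) (p i j))
      ≤ gridSum m n h (fun i j => energyDensity bc be (a i j) (p i j) (o i j))
        + s * (3 * (L₁ * L₂ * M) ^ 2 + 6 * M ^ 2) * gridSum m n h (fun i j =>
          p i j ^ 2 + q i j ^ 2 + o i j ^ 2 + p i j ^ 4 + q i j ^ 4)
        + 4 * M ^ 2 * s * gridSum m n h (fun i j => σ * (|p i j| + |q i j| + |o i j|)) := by
  set S : GridFun := fun i j => p i j ^ 2 + q i j ^ 2 + o i j ^ 2 + p i j ^ 4 + q i j ^ 4 with hS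
  set e : GridFun := fun i j => 3 / 2 * p i j - 1 / 2 * o i j with he
  set v : GridFun := gridConv m n h J e with hv
  set u : GridFun := fun i j => localError bc be (a i j) (b i j) (o i j) (p i j) (q i j) with hu
  have hep : IsGridPeriodic m n e := fun i j k l => by simp only [he, hpp i j k l, hop i j k l]
  have hvp : IsGridPeriodic m n v := gridConv_periodic J hep
  have hup : IsGridPeriodic m n u := fun i j k l => by
    simp only [hu, hpp i j k l, hop i j k l, hqp i j k l, hap i j k l, hbp i j k l]
  have hA : 0 ≤ L₁ * L₂ := by
    have := gridSum_const (h := h) hg 1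
    have h1 : 0 ≤ gridSum m n h (fun _ _ => (1 : ℝ)) := gridSum_nonneg fun _ _ => zero_le_one
    linarith
  have hσ0 : 0 ≤ σ := (abs_nonneg _).trans (hτ 0 0)
  have hS0 : 0 ≤ gridSum m n h S := gridSum_nonneg fun i j => by positivity
  -- The factors multiply to 1/4 · 2 · 5 = 5/2 ≤ 3: Young's inequality, the two coordinate
  -- directions, and |3p/2 − o/2|² ≤ 5(p² + o²).
  have d1 : gridSum m n h (fun i j => gridLaplacian h (fun i j => u i j - v i j) i j * u i j)
      ≤ 3 * (L₁ * L₂ * M) ^ 2 * gridSum m n h S := by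
    have t1 := gridSum_laplacian_sub_mul_le hup hvp hg.h_pos
    have t2 := gridSum_grad_gridConv_le (h := h) hg hJ hep hJ₁ hJ₂
    have t3 : gridSum m n h (fun i j => e i j ^ 2) ≤ 5 * gridSum m n h S := by
      rw [← gridSum_smul]
      refine gridSum_mono fun i j => ?_
      have : 0 ≤ q i j ^ 2 + p i j ^ 4 + q i j ^ 4 := by positivity
      simp only [he, hS]
      nlinarith [sq_nonneg (3 / 2 * p i j + 1 / 2 * o i j), sq_nonneg (p i j), sq_nonneg (o i j)]
    have t4 := mul_le_mul_of_nonneg_left t3 (sq_nonneg (L₁ * L₂ * M))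
    have t5 := mul_nonneg (sq_nonneg (L₁ * L₂ * M)) hS0
    linarith
  have d2 : ∀ i j, energyDensity bc be (b i j) (q i j) (p i j)
      ≤ energyDensity bc be (a i j) (p i j) (o i j)
        + s * (gridLaplacian h (fun i j => u i j - v i j) i j * u i j)
        + s * (6 * M ^ 2) * S i j + 4 * M ^ 2 * s * (σ * (|p i j| + |q i j| + |o i j|)) := by
    intro i j
    have t1 := energyDensity_step (bc := bc) hbe (a i j) (b i j) (o i j) (p i j) (q i j)
    have t2 : |u i j| ≤ _ :=
      abs_localError_le hM hbe hbc hbM (ha i j) (hb i j) (o i j) (p i j) (q i j)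
    have t3 := abs_etaRem_le hM (ha i j) (hb i j) (p i j) (q i j)
    have tS : p i j ^ 2 + q i j ^ 2 + p i j ^ 4 + q i j ^ 4 ≤ S i j := by
      simp only [hS]; nlinarith [sq_nonneg (o i j)]
    have tS0 : 0 ≤ S i j := le_trans (by positivity) tS
    have t4 : |etaRem (a i j) (b i j) (p i j) (q i j)| * |b i j - a i j|
        ≤ (2 * M * S i j) * (M * s) :=
      mul_le_mul (t3.trans (mul_le_mul_of_nonneg_left tS (by linarith))) (hab i j)
        (abs_nonneg _) (by positivity)
    -- Only the linear part of `u` keeps the factor `σ`. In the higher-order part the crude bound `σ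
    -- ≤ 2 * M` suffices, since that part is already controlled by the energy.
    have t5 : -(τ i j * u i j) ≤ σ * (4 * M ^ 2 * (|p i j| + |q i j| + |o i j|))
        + 2 * M * (2 * M * S i j) := by
      calc -(τ i j * u i j) ≤ |τ i j * u i j| := neg_le_abs _
        _ = |τ i j| * |u i j| := abs_mul _ _
        _ ≤ σ * |u i j| := mul_le_mul_of_nonneg_right (hτ i j) (abs_nonneg _)
        _ ≤ σ * (4 * M ^ 2 * (|p i j| + |q i j| + |o i j|) + 2 * M * S i j) :=
            mul_le_mul_of_nonneg_left
              (t2.trans (add_le_add_right (mul_le_mul_of_nonneg_left tS (by linarith)) _)) hσ0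
        _ ≤ _ := by
            have := mul_le_mul_of_nonneg_right hσ (show 0 ≤ 2 * M * S i j by positivity)
            linarith
    have t6 := heq i j
    have t7 : (q i j - p i j) * u i j
        = s * (gridLaplacian h (fun i j => u i j - v i j) i j * u i j)
          + s * (-(τ i j * u i j)) := by rw [t6]; ring
    have t8 := mul_le_mul_of_nonneg_left t5 hs.le
    change _ ≤ _ + (q i j - p i j) * u i j + _ at t1
    rw [t7] at t1
    linarith
  have d3 := gridSum_mono (m := m) (n := n) (h := h) d2
  rw [gridSum_add, gridSum_add, gridSum_add, gridSum_smul, gridSum_smul, gridSum_smul] at d3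
  have d4 := mul_le_mul_of_nonneg_left d1 hs.le
  linarith

theorem gridSum_powers_le (hα : 0 < α) (hbe : 0 ≤ be) (hb : α ≤ bc - be) (x ε o : GridFun) :
    gridSum m n h (fun i j => ε i j ^ 2)
        ≤ 2 / α * gridSum m n h (fun i j => energyDensity bc be (x i j) (ε i j) (o i j))
      ∧ gridSum m n h (fun i j => ε i j ^ 4)
        ≤ 12 * gridSum m n h (fun i j => energyDensity bc be (x i j) (ε i j) (o i j)) := by
  constructor
  · rw [← gridSum_smul]
    exact gridSum_mono fun i j => (energyDensity_bound hα hbe hb _ _ _).1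
  · rw [← gridSum_smul]
    exact gridSum_mono fun i j => (energyDensity_bound hα hbe hb _ _ _).2

end Step

/-- A discrete Gronwall inequality with an implicit term. -/
theorem discrete_gronwall {X : ℕ → ℝ} {N : ℕ} {x D D₀ : ℝ} (hx : 0 ≤ x) (hx2 : x ≤ 1 / 2)
    (hD : 0 ≤ D) (hD₀ : 0 ≤ D₀) (h0 : X 0 ≤ 0) (h1 : 1 ≤ N → X 1 ≤ D₀)
    (hstep : ∀ k, k + 2 ≤ N →
      X (k + 2) ≤ X (k + 1) + x * (X (k + 2) + X (k + 1) + X k) + D) :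
    ∀ k ≤ N, X k ≤ (D₀ + k * D) * (1 + 6 * x) ^ k := by
  -- The recursion reaches two levels back, so the induction carries two consecutive values under
  -- the same bound, the later one.
  have key : ∀ k, k + 1 ≤ N → X k ≤ (D₀ + (k + 1 : ℕ) * D) * (1 + 6 * x) ^ (k + 1)
      ∧ X (k + 1) ≤ (D₀ + (k + 1 : ℕ) * D) * (1 + 6 * x) ^ (k + 1) := by
    intro k
    induction k with
    | zero =>
      intro hN
      have e : D₀ ≤ (D₀ + ((0 + 1 : ℕ) : ℝ) * D) * (1 + 6 * x) ^ (0 + 1) := by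
        simp only [zero_add, Nat.cast_one, one_mul, pow_one]
        nlinarith [mul_nonneg hD hx, mul_nonneg hD₀ hx]
      exact ⟨by linarith, (h1 hN).trans e⟩
    | succ k ih =>
      intro hN
      obtain ⟨i1, i2⟩ := ih (by omega)
      set B := D₀ + ((k + 1 : ℕ) : ℝ) * D with hB
      set R := (1 + 6 * x) ^ (k + 1) with hR
      have hB0 : 0 ≤ B := by positivity
      have hR1 : 1 ≤ R := one_le_pow₀ (by linarith)
      have e1 : D₀ + ((k + 1 + 1 : ℕ) : ℝ) * D = B + D := by rw [hB]; push_cast; ring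
      have e2 : (1 + 6 * x) ^ (k + 1 + 1) = R * (1 + 6 * x) := pow_succ _ _
      rw [e1, e2]
      have hBR : 0 ≤ B * R := by positivity
      have hDR : D ≤ D * R := le_mul_of_one_le_right hD hR1
      have hxDR : 0 ≤ x * (D * R) := by positivity
      have hxBR : 0 ≤ x * (B * R) := by positivity
      refine ⟨by nlinarith, ?_⟩
      have st := hstep k hN
      have s1 : (1 - x) * X (k + 2) ≤ (1 + 2 * x) * (B * R) + D * R := by nlinarith
      have s2 : (1 + 2 * x) * (B * R) + D * R
          ≤ (1 - x) * ((B + D) * (R * (1 + 6 * x))) := by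
        -- Equivalent to 3x − 6x² ≥ 0, which is where `x ≤ 1 / 2` is used. The growth rate 6 pays
        -- both for the explicit terms and for dividing by 1 − x.
        have f1 : 1 + 2 * x ≤ (1 - x) * (1 + 6 * x) := by nlinarith
        have f2 : 1 ≤ (1 - x) * (1 + 6 * x) := by nlinarith
        nlinarith [mul_le_mul_of_nonneg_right f1 hBR,
          mul_le_mul_of_nonneg_right f2 (show 0 ≤ D * R by positivity)]
      exact le_of_mul_le_mul_left (s1.trans s2) (by linarith)
  intro k hk
  rcases k with _ | k
  · simpa using h0.trans hD₀
  · exact (key k hk).2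

section Step

variable {m n : ℕ} {h s L₁ L₂ M α bc be σ : ℝ} {J a b o p q τ : GridFun}

theorem gridLaplacian_sub (f g : GridFun) (i j : ℤ) :
    gridLaplacian h (fun i j => f i j - g i j) i j
      = gridLaplacian h f i j - gridLaplacian h g i j := by
  unfold gridLaplacian; ring

/-- Bounds every power of the errors in one step by the energies at three consecutive levels. The
oldest level contributes only a square, and its fourth power is added for free. -/
theorem gridSum_step_powers_le (hα : 0 < α) (hbe : 0 ≤ be) (hb : α ≤ bc - be)
    (x y z p' : GridFun) :
    gridSum m n h (fun i j => p i j ^ 2 + q i j ^ 2 + o i j ^ 2 + p i j ^ 4 + q i j ^ 4)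
      ≤ (12 + 2 / α) * (gridSum m n h (fun i j => energyDensity bc be (y i j) (q i j) (p i j))
        + gridSum m n h (fun i j => energyDensity bc be (x i j) (p i j) (o i j))
        + gridSum m n h (fun i j => energyDensity bc be (z i j) (o i j) (p' i j))) := by
  have h1 := gridSum_powers_le (m := m) (n := n) (h := h) hα hbe hb y q p
  have h2 := gridSum_powers_le (m := m) (n := n) (h := h) hα hbe hb x p o
  have h3 := gridSum_powers_le (m := m) (n := n) (h := h) hα hbe hb z o p'
  have h4 : 0 ≤ gridSum m n h (fun i j => o i j ^ 4) := gridSum_nonneg fun i j => by positivity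
  simp only [gridSum_add]
  linarith

/-- The energy step with the consistency term absorbed; used away from the first step. -/
theorem gridSum_energyDensity_step_young (hg : IsGrid L₁ L₂ m n h) (hs : 0 < s) (hM : 1 ≤ M)
    (h1 : gridSum m n h (fun i j => energyDensity bc be (b i j) (q i j) (p i j))
      ≤ gridSum m n h (fun i j => energyDensity bc be (a i j) (p i j) (o i j))
        + s * (3 * (L₁ * L₂ * M) ^ 2 + 6 * M ^ 2) * gridSum m n h (fun i j =>
          p i j ^ 2 + q i j ^ 2 + o i j ^ 2 + p i j ^ 4 + q i j ^ 4)
        + 4 * M ^ 2 * s * gridSum m n h (fun i j => σ * (|p i j| + |q i j| + |o i j|))) :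
    gridSum m n h (fun i j => energyDensity bc be (b i j) (q i j) (p i j))
      ≤ gridSum m n h (fun i j => energyDensity bc be (a i j) (p i j) (o i j))
        + s * (3 * (L₁ * L₂ * M) ^ 2 + 10 * M ^ 2) * gridSum m n h (fun i j =>
          p i j ^ 2 + q i j ^ 2 + o i j ^ 2 + p i j ^ 4 + q i j ^ 4)
        + s * (12 * M ^ 2 * (L₁ * L₂) * σ ^ 2) := by
  have h2 : gridSum m n h (fun i j => σ * (|p i j| + |q i j| + |o i j|))
      ≤ gridSum m n h (fun i j => 3 * σ ^ 2
        + (p i j ^ 2 + q i j ^ 2 + o i j ^ 2 + p i j ^ 4 + q i j ^ 4)) := by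
    refine gridSum_mono fun i j => ?_
    have y : ∀ t : ℝ, σ * |t| ≤ σ ^ 2 + t ^ 2 := fun t => by
      rw [← sq_abs t]; nlinarith [sq_nonneg (σ - |t|), sq_nonneg σ, sq_nonneg |t|]
    have : 0 ≤ p i j ^ 4 + q i j ^ 4 := by positivity
    nlinarith [y (p i j), y (q i j), y (o i j)]
  rw [gridSum_add, gridSum_const hg] at h2
  have h3 := mul_le_mul_of_nonneg_left h2 (show 0 ≤ 4 * M ^ 2 * s by positivity)
  linarith

/-- The energy after the first step, which starts from vanishing errors. -/
theorem gridSum_energyDensity_first_step (hg : IsGrid L₁ L₂ m n h) (hs : 0 < s) (hM : 1 ≤ M)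
    (hα : 0 < α) (hbe : 0 ≤ be) (hb : α ≤ bc - be)
    (hp0 : ∀ i j, p i j = 0) (ho0 : ∀ i j, o i j = 0)
    (hsΛ : s * ((3 * (L₁ * L₂ * M) ^ 2 + 10 * M ^ 2) * (12 + 2 / α)) ≤ 1 / 4)
    (h1 : gridSum m n h (fun i j => energyDensity bc be (b i j) (q i j) (p i j))
      ≤ gridSum m n h (fun i j => energyDensity bc be (a i j) (p i j) (o i j))
        + s * (3 * (L₁ * L₂ * M) ^ 2 + 6 * M ^ 2) * gridSum m n h (fun i j =>
          p i j ^ 2 + q i j ^ 2 + o i j ^ 2 + p i j ^ 4 + q i j ^ 4)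
        + 4 * M ^ 2 * s * gridSum m n h (fun i j => σ * (|p i j| + |q i j| + |o i j|))) :
    gridSum m n h (fun i j => energyDensity bc be (b i j) (q i j) (p i j))
      ≤ 64 * (L₁ * L₂) * M ^ 4 / α * (s * σ) ^ 2 := by
  set E := gridSum m n h (fun i j => energyDensity bc be (b i j) (q i j) (p i j)) with hE
  have e0 : gridSum m n h (fun i j => energyDensity bc be (a i j) (p i j) (o i j)) = 0 := by
    simp [hp0, ho0, energyDensity, relQuartic, gridSum]
  obtain ⟨q2, q4⟩ := gridSum_powers_le (m := m) (n := n) (h := h) hα hbe hb b q p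
  rw [← hE] at q2 q4
  have eS : gridSum m n h (fun i j => p i j ^ 2 + q i j ^ 2 + o i j ^ 2 + p i j ^ 4 + q i j ^ 4)
      ≤ (12 + 2 / α) * E := by
    have : (fun i j => p i j ^ 2 + q i j ^ 2 + o i j ^ 2 + p i j ^ 4 + q i j ^ 4)
        = fun i j => q i j ^ 2 + q i j ^ 4 := by
      funext i j; rw [hp0, ho0]; ring
    rw [this, gridSum_add]
    linarith
  have hE0 : 0 ≤ E := by
    have : 0 ≤ gridSum m n h (fun i j => q i j ^ 4) := gridSum_nonneg fun i j => by positivity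
    linarith
  have y1 : 4 * M ^ 2 * s * gridSum m n h (fun i j => σ * (|p i j| + |q i j| + |o i j|))
      ≤ gridSum m n h (fun i j => α / 8 * q i j ^ 2 + 32 * M ^ 4 / α * (s * σ) ^ 2) := by
    rw [← gridSum_smul]
    refine gridSum_mono fun i j => ?_
    rw [hp0, ho0]
    -- Young's inequality with weight α/8, chosen so that coercivity turns the quadratic part into a
    -- quarter of the energy. Leaving `s` inside the square preserves (sσ)²; the estimate for later
    -- steps would give only sσ², which is not enough for a first-order `σ`.
    have : 0 ≤ (α * |q i j| - 16 * (M ^ 2 * s * σ)) ^ 2 / (8 * α) := by positivity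
    have e : (α * |q i j| - 16 * (M ^ 2 * s * σ)) ^ 2 / (8 * α)
        = α / 8 * |q i j| ^ 2 + 32 * M ^ 4 / α * (s * σ) ^ 2 - 4 * M ^ 2 * s * (σ * |q i j|) := by
      field_simp; ring
    rw [e, sq_abs] at this
    simp only [abs_zero, zero_add, add_zero]
    linarith
  rw [gridSum_add, gridSum_smul (α / 8), gridSum_const hg] at y1
  have y2 : α / 8 * gridSum m n h (fun i j => q i j ^ 2) ≤ E / 4 := by
    calc _ ≤ α / 8 * (2 / α * E) := mul_le_mul_of_nonneg_left q2 (by positivity)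
      _ = E / 4 := by field_simp; ring
  have y3 : s * (3 * (L₁ * L₂ * M) ^ 2 + 6 * M ^ 2) * gridSum m n h (fun i j =>
      p i j ^ 2 + q i j ^ 2 + o i j ^ 2 + p i j ^ 4 + q i j ^ 4) ≤ E / 4 := by
    calc _ ≤ s * (3 * (L₁ * L₂ * M) ^ 2 + 10 * M ^ 2) * ((12 + 2 / α) * E) := by
          refine mul_le_mul ?_ eS (gridSum_nonneg fun i j => by positivity) (by positivity)
          exact mul_le_mul_of_nonneg_left (by nlinarith [sq_nonneg M]) hs.le
      _ = s * ((3 * (L₁ * L₂ * M) ^ 2 + 10 * M ^ 2) * (12 + 2 / α)) * E := by ring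
      _ ≤ 1 / 4 * E := mul_le_mul_of_nonneg_right hsΛ hE0
      _ = E / 4 := by ring
  have e2 : 64 * (L₁ * L₂) * M ^ 4 / α * (s * σ) ^ 2
      = 2 * (L₁ * L₂ * (32 * M ^ 4 / α * (s * σ) ^ 2)) := by ring
  rw [e2]
  linarith

end Step

/-- The discrete chemical potential of the scheme, with its coefficients as parameters. -/
def potential (m n : ℕ) (h bc be : ℝ) (J : GridFun) (φ : ℕ → GridFun) (k : ℕ) : GridFun :=
  fun i j => eta (φ k i j) (φ (k + 1) i j) + bc * midLevel φ k i j - be * extrapLevel φ k i j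
    - gridConv m n h J (extrapLevel φ k) i j

/-- Two sequences that solve the scheme up to a consistency error (of second order, and of first
order in the first time step) differ by a term of second order. -/
theorem scheme_stability (L₁ L₂ α M : ℝ) (hA : 0 < L₁ * L₂) (hα : 0 < α) (hM : 1 ≤ M) :
    ∃ s₀ > 0, ∃ C > 0, ∀ (m n : ℕ) (h s : ℝ), IsGrid L₁ L₂ m n h → h ≤ 1 → 0 < s → s ≤ s₀ →
      ∀ (bc be : ℝ) (J : GridFun), α ≤ bc - be → 0 ≤ be → bc ≤ M → IsGridPeriodic m n J →
      (∀ k l, |J (k + 1) l - J k l| ≤ M * h) → (∀ k l, |J k (l + 1) - J k l| ≤ M * h) →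
      ∀ (Ψ φ : ℕ → GridFun) (N : ℕ), N * s ≤ M → φ 0 = Ψ 0 →
      (∀ k ≤ N, IsGridPeriodic m n (φ k)) → (∀ k ≤ N, IsGridPeriodic m n (Ψ k)) →
      (∀ k ≤ N, ∀ i j, |Ψ k i j| ≤ M) →
      (∀ k < N, ∀ i j, |Ψ (k + 1) i j - Ψ k i j| ≤ M * s) →
      (∀ k < N, ∀ i j, φ (k + 1) i j - φ k i j
        = s * gridLaplacian h (potential m n h bc be J φ k) i j) →
      (∀ i j, 0 < N → |Ψ 1 i j - Ψ 0 i j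
        - s * gridLaplacian h (potential m n h bc be J Ψ 0) i j| ≤ s * (M * (h ^ 2 + s))) →
      (∀ k, k + 1 < N → ∀ i j, |Ψ (k + 2) i j - Ψ (k + 1) i j
        - s * gridLaplacian h (potential m n h bc be J Ψ (k + 1)) i j|
          ≤ s * (M * (h ^ 2 + s ^ 2))) →
      gridSum m n h (fun i j => (φ N i j - Ψ N i j) ^ 2) ≤ C * (h ^ 2 + s ^ 2) ^ 2 := by
  set Λ := (3 * (L₁ * L₂ * M) ^ 2 + 10 * M ^ 2) * (12 + 2 / α) with hΛ
  have hΛ0 : 0 < Λ := by positivity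
  -- The first summand is the energy created in the first step; the second accumulates the later
  -- truncation errors, with N s ≤ M.
  set B := 64 * (L₁ * L₂) * M ^ 6 / α + 12 * M ^ 5 * (L₁ * L₂) with hB
  have hB0 : 0 < B := by positivity
  -- The bound 1/(4Λ) gives s Λ ≤ 1/4, as required for absorbing the implicit terms of the first
  -- step, and it also meets the condition of the Gronwall lemma. The final constant is coercivity
  -- times data times growth up to N s ≤ M.
  refine ⟨min 1 (1 / (4 * Λ)), by positivity, 2 / α * (B * Real.exp (6 * Λ * M)), by positivity, ?_⟩
  intro m n h s hg hh1 hs hs0 bc be J hb hbe hbM hJ hJ₁ hJ₂ Ψ φ N hN h0 hφp hΨp hΨ hΨ' hφ hτ₀ hτ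
  have hh := hg.h_pos
  have hs1 : s ≤ 1 := hs0.trans (min_le_left _ _)
  have hsΛ : s * Λ ≤ 1 / 4 := by
    have := mul_le_mul_of_nonneg_right (hs0.trans (min_le_right _ _)) hΛ0.le
    calc s * Λ ≤ 1 / (4 * Λ) * Λ := this
      _ = 1 / 4 := by field_simp
  have hh2 : h ^ 2 ≤ 1 := pow_le_one₀ hh.le hh1
  have hs2 : s ^ 2 ≤ 1 := pow_le_one₀ hs.le hs1
  set ε : ℕ → GridFun := fun k i j => φ k i j - Ψ k i j with hε
  have hεp : ∀ k ≤ N, IsGridPeriodic m n (ε k) := fun k hk i j p q => by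
    simp only [hε, hφp k hk i j p q, hΨp k hk i j p q]
  have hpp : ∀ k ≤ N, IsGridPeriodic m n (prevLevel ε k) := by
    intro k hk
    cases k with
    | zero => exact hεp 0 hk
    | succ k => exact hεp k (by omega)
  have hprev : ∀ k i j, prevLevel ε k i j = prevLevel φ k i j - prevLevel Ψ k i j := by
    intro k i j; cases k <;> rfl
  have hε0 : ∀ i j, ε 0 i j = 0 := fun i j => by simp only [hε, h0, sub_self]
  set X : ℕ → ℝ := fun k =>
    gridSum m n h (fun i j => energyDensity bc be (Ψ k i j) (ε k i j) (prevLevel ε k i j)) with hX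
  have step : ∀ (k : ℕ) (σ : ℝ), k < N → σ ≤ 2 * M →
      (∀ i j, |Ψ (k + 1) i j - Ψ k i j
        - s * gridLaplacian h (potential m n h bc be J Ψ k) i j| ≤ s * σ) →
      X (k + 1) ≤ X k
        + s * (3 * (L₁ * L₂ * M) ^ 2 + 6 * M ^ 2) * gridSum m n h (fun i j =>
          ε k i j ^ 2 + ε (k + 1) i j ^ 2 + prevLevel ε k i j ^ 2 + ε k i j ^ 4
            + ε (k + 1) i j ^ 4)
        + 4 * M ^ 2 * s * gridSum m n h (fun i j =>
          σ * (|ε k i j| + |ε (k + 1) i j| + |prevLevel ε k i j|)) := by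
    intro k σ hk hσ hres
    refine gridSum_energyDensity_step (p := ε k) (q := ε (k + 1)) (o := prevLevel ε k) (τ := fun i j => (Ψ (k + 1) i j - Ψ k i j
        - s * gridLaplacian h (potential m n h bc be J Ψ k) i j) / s) hg hs hM hbe (by linarith)
      hbM hJ hJ₁ hJ₂ (hΨ k hk.le) (hΨ _ hk) (hΨ' k hk) (hΨp k hk.le) (hΨp _ hk) (hpp k hk.le)
      (hεp k hk.le) (hεp _ hk) (fun i j => ?_) hσ (fun i j => ?_)
    · rw [abs_div, abs_of_pos hs, div_le_iff₀ hs, mul_comm σ s]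
      exact hres i j
    -- Extrapolation and convolution are linear and the previous level of the error is the error of
    -- the previous level, so the difference of the two potentials depends only on the errors and
    -- the exact values.
    · have e : (fun i j => localError bc be (Ψ k i j) (Ψ (k + 1) i j) (prevLevel ε k i j)
            (ε k i j) (ε (k + 1) i j)
          - gridConv m n h J (fun i j => 3 / 2 * ε k i j - 1 / 2 * prevLevel ε k i j) i j)
          = fun i j => potential m n h bc be J φ k i j - potential m n h bc be J Ψ k i j := by
        funext i j
        have e1 : (fun i j => 3 / 2 * ε k i j - 1 / 2 * prevLevel ε k i j)
            = fun i j => extrapLevel φ k i j - extrapLevel Ψ k i j := by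
          funext i j
          simp only [hprev]
          simp only [extrapLevel, hε]
          ring
        rw [e1, gridConv_sub]
        simp only [hprev]
        simp only [potential, localError, midLevel, hε, add_sub_cancel]
        simp only [extrapLevel]
        ring
      rw [e, gridLaplacian_sub, mul_div_cancel₀ _ hs.ne', mul_sub, ← hφ k hk]
      simp only [hε]
      ring
  have X0 : X 0 ≤ 0 := by
    have : ∀ i j, prevLevel ε 0 i j = 0 := hε0
    simp [hX, hε0, this, energyDensity, relQuartic, gridSum]
  have X1 : 1 ≤ N → X 1 ≤ 64 * (L₁ * L₂) * M ^ 6 / α * (h ^ 2 + s ^ 2) ^ 2 := by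
    intro h1N
    have hσ : M * (h ^ 2 + s) ≤ 2 * M := by nlinarith
    have st := gridSum_energyDensity_first_step (σ := M * (h ^ 2 + s)) hg hs hM hα hbe hb hε0
      (o := prevLevel ε 0) hε0 hsΛ (step 0 _ h1N hσ (fun i j => hτ₀ i j h1N))
    refine st.trans ?_
    -- The extra factor `s` lifts the first-order truncation error to second order; `s ≤ 1` handles
    -- the h² term.
    have e : s * (M * (h ^ 2 + s)) ≤ M * (h ^ 2 + s ^ 2) := by
      nlinarith [mul_nonneg (zero_le_one.trans hM) (mul_nonneg (sub_nonneg.2 hs1) (sq_nonneg h))]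
    have e2 := pow_le_pow_left₀ (by positivity) e 2
    calc _ ≤ 64 * (L₁ * L₂) * M ^ 4 / α * (M * (h ^ 2 + s ^ 2)) ^ 2 :=
          mul_le_mul_of_nonneg_left e2 (by positivity)
      _ = _ := by ring
  have Xs : ∀ k, k + 2 ≤ N → X (k + 2) ≤ X (k + 1) + s * Λ * (X (k + 2) + X (k + 1) + X k)
      + s * (12 * M ^ 4 * (L₁ * L₂) * (h ^ 2 + s ^ 2) ^ 2) := by
    intro k hk
    have hσ : M * (h ^ 2 + s ^ 2) ≤ 2 * M := by nlinarith
    have st := gridSum_energyDensity_step_young (σ := M * (h ^ 2 + s ^ 2)) hg hs hM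
      (step (k + 1) _ (by omega) hσ (hτ k (by omega)))
    have pw := gridSum_step_powers_le (m := m) (n := n) (h := h) (p := ε (k + 1))
      (q := ε (k + 2)) (o := ε k) hα hbe hb (Ψ (k + 1)) (Ψ (k + 2)) (Ψ k) (prevLevel ε k)
    have pw2 := mul_le_mul_of_nonneg_left pw
      (show 0 ≤ s * (3 * (L₁ * L₂ * M) ^ 2 + 10 * M ^ 2) by positivity)
    refine st.trans ?_
    have e : s * (12 * M ^ 2 * (L₁ * L₂) * (M * (h ^ 2 + s ^ 2)) ^ 2)
        = s * (12 * M ^ 4 * (L₁ * L₂) * (h ^ 2 + s ^ 2) ^ 2) := by ring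
    rw [e]
    refine add_le_add_left (add_le_add_right (pw2.trans (le_of_eq ?_)) _) _
    rw [hΛ, ← mul_assoc, ← mul_assoc]
    rfl
  have gr := discrete_gronwall (by positivity) (by linarith) (by positivity) (by positivity)
    X0 X1 Xs N le_rfl
  have r1 : (1 + 6 * (s * Λ)) ^ N ≤ Real.exp (6 * Λ * M) := by
    calc (1 + 6 * (s * Λ)) ^ N ≤ (Real.exp (6 * (s * Λ))) ^ N :=
          pow_le_pow_left₀ (by positivity) (by linarith [Real.add_one_le_exp (6 * (s * Λ))]) N
      _ = Real.exp (6 * Λ * (N * s)) := by rw [← Real.exp_nat_mul]; congr 1; ring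
      _ ≤ _ := Real.exp_le_exp.mpr (mul_le_mul_of_nonneg_left hN (by positivity))
  have r2 : 64 * (L₁ * L₂) * M ^ 6 / α * (h ^ 2 + s ^ 2) ^ 2
      + N * (s * (12 * M ^ 4 * (L₁ * L₂) * (h ^ 2 + s ^ 2) ^ 2)) ≤ B * (h ^ 2 + s ^ 2) ^ 2 := by
    have := mul_le_mul_of_nonneg_right hN
      (show 0 ≤ 12 * M ^ 4 * (L₁ * L₂) * (h ^ 2 + s ^ 2) ^ 2 by positivity)
    rw [hB]
    linarith
  have r3 := (gridSum_powers_le (m := m) (n := n) (h := h) hα hbe hb (Ψ N) (ε N)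
    (prevLevel ε N)).1
  calc _ ≤ 2 / α * X N := r3
    _ ≤ 2 / α * (B * (h ^ 2 + s ^ 2) ^ 2 * Real.exp (6 * Λ * M)) :=
        mul_le_mul_of_nonneg_left
          (gr.trans (mul_le_mul r2 r1 (by positivity) (by positivity))) (by positivity)
    _ = _ := by ring

/-! ### Taylor's formula with one-sided derivatives -/

/-- Induction on the order: the derivative of the remainder is the remainder of the derivative, one
order lower, and the mean value inequality on the segment supplies one more power of |b − a|.
Derivatives within `S` allow expansions up to the ends of [0, T]. The factorial in the remainder is
given up. -/
theorem abs_taylor_remainder_le {S : Set ℝ} (hS : Convex ℝ S) {W a b : ℝ} (ha : a ∈ S)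
    (hb : b ∈ S) (N : ℕ) : ∀ g : ℕ → ℝ → ℝ,
    (∀ k < N, ∀ x ∈ S, HasDerivWithinAt (g k) (g (k + 1) x) S x) → (∀ x ∈ S, |g N x| ≤ W) →
    |g 0 b - ∑ k ∈ Finset.range N, (b - a) ^ k / (k.factorial : ℝ) * g k a|
      ≤ W * |b - a| ^ N := by
  induction N generalizing b with
  | zero => intro g _ hW; simpa using hW b hb
  | succ N ih =>
    intro g hg hW
    set r : ℝ → ℝ := fun τ => g 0 τ
      - ∑ k ∈ Finset.range (N + 1), (τ - a) ^ k / (k.factorial : ℝ) * g k a with hr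
    have hder : ∀ τ ∈ S, HasDerivWithinAt r
        (g 1 τ - ∑ k ∈ Finset.range N, (τ - a) ^ k / (k.factorial : ℝ) * g (k + 1) a) S τ := by
      intro τ hτ
      refine (hg 0 (by omega) τ hτ).sub ?_
      have e : (fun τ => ∑ k ∈ Finset.range (N + 1), (τ - a) ^ k / (k.factorial : ℝ) * g k a)
          = fun τ => ∑ k ∈ Finset.range N,
            (τ - a) ^ (k + 1) / ((k + 1).factorial : ℝ) * g (k + 1) a + g 0 a := by
        funext τ; rw [Finset.sum_range_succ']; simp
      rw [e]
      refine HasDerivWithinAt.add_const _ (HasDerivWithinAt.fun_sum fun k _ => ?_)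
      have := ((((hasDerivWithinAt_id τ S).sub_const a).pow (k + 1)).div_const
        ((k + 1).factorial : ℝ)).mul_const (g (k + 1) a)
      refine this.congr_deriv ?_
      have hk : ((k + 1).factorial : ℝ) = (k + 1) * k.factorial := by
        rw [Nat.factorial_succ]; push_cast; ring
      have : (k.factorial : ℝ) ≠ 0 := by positivity
      have : (k : ℝ) + 1 ≠ 0 := by positivity
      rw [hk]
      simp only [id, Nat.add_sub_cancel, mul_one, Nat.cast_add, Nat.cast_one]
      field_simp
    have hsub : uIcc a b ⊆ S := hS.ordConnected.uIcc_subset ha hb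
    have hbd : ∀ τ ∈ uIcc a b,
        ‖g 1 τ - ∑ k ∈ Finset.range N, (τ - a) ^ k / (k.factorial : ℝ) * g (k + 1) a‖
          ≤ W * |b - a| ^ N := by
      intro τ hτ
      have h1 := ih (hsub hτ) (fun k => g (k + 1)) (fun k hk x hx => hg (k + 1) (by omega) x hx) hW
      rw [Real.norm_eq_abs]
      refine h1.trans (mul_le_mul_of_nonneg_left ?_ ((abs_nonneg _).trans (hW b hb)))
      exact pow_le_pow_left₀ (abs_nonneg _) (abs_sub_left_of_mem_uIcc hτ) N
    have mv := (convex_uIcc a b).norm_image_sub_le_of_norm_hasDerivWithin_le (f := r)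
      (fun τ hτ => (hder τ (hsub hτ)).mono hsub) hbd left_mem_uIcc right_mem_uIcc
    have ra : r a = 0 := by
      simp only [hr]; rw [Finset.sum_range_succ']; simp
    rw [ra, sub_zero, Real.norm_eq_abs, Real.norm_eq_abs, mul_assoc, ← pow_succ] at mv
    exact mv

/-! ### Smooth periodic functions of time and space -/

/-- The unit vectors of the plane. -/
def unitVec (i : Fin 2) : Plane := EuclideanSpace.single i 1

/-- `F` is smooth on `[0, T] × ℝ²` and periodic in space. -/
structure SmoothPeriodic (L₁ L₂ T : ℝ) (F : ℝ → Plane → ℝ) : Prop where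
  smooth : ContDiffOn ℝ ∞ (fun p : ℝ × Plane => F p.1 p.2) (Icc 0 T ×ˢ univ)
  periodic : ∀ t ∈ Icc 0 T, IsPeriodic L₁ L₂ (F t)

/-- The time derivative, one-sided at the ends of `[0, T]`. -/
def timeDeriv (T : ℝ) (F : ℝ → Plane → ℝ) : ℝ → Plane → ℝ :=
  fun t x => derivWithin (fun τ => F τ x) (Icc 0 T) t

/-- A spatial partial derivative. -/
def spaceDeriv (i : Fin 2) (F : ℝ → Plane → ℝ) : ℝ → Plane → ℝ :=
  fun t x => fderiv ℝ (F t) x (unitVec i)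

/-- Periodicity reduces every point to one closed period cell, where compactness applies. General
values `E` allow the use for Fréchet derivatives. -/
theorem exists_norm_bound {E : Type*} [NormedAddCommGroup E] {L₁ L₂ T : ℝ} (hL₁ : 0 < L₁)
    (hL₂ : 0 < L₂) {F : ℝ → Plane → E}
    (hc : ContinuousOn (fun p : ℝ × Plane => F p.1 p.2) (Icc 0 T ×ˢ univ))
    (hp : ∀ t ∈ Icc 0 T, ∀ x, F t (x + !₂[L₁, 0]) = F t x ∧ F t (x + !₂[0, L₂]) = F t x) :
    ∃ K, ∀ t ∈ Icc 0 T, ∀ x, ‖F t x‖ ≤ K := by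
  have hcont : Continuous (fun q : ℝ × ℝ × ℝ => ((q.1, !₂[q.2.1, q.2.2]) : ℝ × Plane)) := by
    refine continuous_fst.prodMk ((PiLp.continuous_toLp 2 _).comp ?_)
    refine continuous_pi fun i => ?_
    fin_cases i <;> simp <;> fun_prop
  have hc' : ContinuousOn (fun q : ℝ × ℝ × ℝ => F q.1 !₂[q.2.1, q.2.2])
      (Icc 0 T ×ˢ Icc 0 L₁ ×ˢ Icc 0 L₂) :=
    hc.comp hcont.continuousOn fun q hq => ⟨hq.1, mem_univ _⟩
  obtain ⟨K, hK⟩ := (isCompact_Icc.prod (isCompact_Icc.prod isCompact_Icc)).exists_bound_of_continuousOn hc'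
  refine ⟨K, fun t ht x => ?_⟩
  have p1 : ∀ b, Function.Periodic (fun a => F t !₂[a, b]) L₁ := fun b a => by
    have := (hp t ht !₂[a, b]).1
    convert this using 2
    ext i; fin_cases i <;> simp
  have p2 : ∀ a, Function.Periodic (fun b => F t !₂[a, b]) L₂ := fun a b => by
    have := (hp t ht !₂[a, b]).2
    convert this using 2
    ext i; fin_cases i <;> simp
  have hx : x = !₂[x 0, x 1] := by ext i; fin_cases i <;> simp
  obtain ⟨a, ha, ha'⟩ := (p1 (x 1)).exists_mem_Ico₀ hL₁ (x 0)
  obtain ⟨b, hb, hb'⟩ := (p2 a).exists_mem_Ico₀ hL₂ (x 1)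
  have e : F t x = F t !₂[a, b] := by
    rw [hx]; exact ha'.trans hb'
  rw [e]
  exact hK (t, a, b) ⟨ht, Ico_subset_Icc_self ha, Ico_subset_Icc_self hb⟩

section SmoothPeriodic

variable {L₁ L₂ T : ℝ} {F G : ℝ → Plane → ℝ}

theorem uniqueDiffOn_strip (hT : 0 < T) : UniqueDiffOn ℝ (Icc 0 T ×ˢ (univ : Set Plane)) :=
  (uniqueDiffOn_Icc hT).prod uniqueDiffOn_univ

theorem SmoothPeriodic.exists_bound (hL₁ : 0 < L₁) (hL₂ : 0 < L₂)
    (hF : SmoothPeriodic L₁ L₂ T F) : ∃ K, ∀ t ∈ Icc 0 T, ∀ x, |F t x| ≤ K :=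
  exists_norm_bound hL₁ hL₂ hF.smooth.continuousOn hF.periodic

theorem SmoothPeriodic.hasFDerivWithinAt (hF : SmoothPeriodic L₁ L₂ T F) {t : ℝ}
    (ht : t ∈ Icc 0 T) (x : Plane) :
    HasFDerivWithinAt (fun p : ℝ × Plane => F p.1 p.2)
      (fderivWithin ℝ (fun p : ℝ × Plane => F p.1 p.2) (Icc 0 T ×ˢ univ) (t, x))
      (Icc 0 T ×ˢ univ) (t, x) :=
  ((hF.smooth.differentiableOn (by simp)) (t, x) (mk_mem_prod ht (mem_univ x))).hasFDerivWithinAt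

/-- Identifies the one-sided time derivative with a component of the joint derivative within the
strip, so that differentiation in time stays within the class of smooth periodic functions. -/
theorem SmoothPeriodic.timeDeriv_eq (hT : 0 < T) (hF : SmoothPeriodic L₁ L₂ T F) {t : ℝ}
    (ht : t ∈ Icc 0 T) (x : Plane) :
    HasDerivWithinAt (fun τ => F τ x) (timeDeriv T F t x) (Icc 0 T) t ∧ timeDeriv T F t x
      = fderivWithin ℝ (fun p : ℝ × Plane => F p.1 p.2) (Icc 0 T ×ˢ univ) (t, x) (1, 0) := by
  have h1 : HasDerivWithinAt (fun τ : ℝ => ((τ, x) : ℝ × Plane)) (1, 0) (Icc 0 T) t :=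
    (hasDerivWithinAt_id t _).prodMk (hasDerivWithinAt_const t _ x)
  have hm : MapsTo (fun τ : ℝ => ((τ, x) : ℝ × Plane)) (Icc 0 T) (Icc 0 T ×ˢ univ) :=
    fun τ hτ => ⟨hτ, mem_univ _⟩
  have h2 := (hF.hasFDerivWithinAt ht x).comp_hasDerivWithinAt t h1 hm
  have h3 := h2.derivWithin (uniqueDiffOn_Icc hT t ht)
  refine ⟨?_, h3⟩
  rw [← h3] at h2
  exact h2

theorem SmoothPeriodic.hasFDerivAt_space (hF : SmoothPeriodic L₁ L₂ T F) {t : ℝ}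
    (ht : t ∈ Icc 0 T) (x : Plane) :
    HasFDerivAt (F t) ((fderivWithin ℝ (fun p : ℝ × Plane => F p.1 p.2) (Icc 0 T ×ˢ univ)
      (t, x)).comp (ContinuousLinearMap.inr ℝ ℝ Plane)) x := by
  have h1 : HasFDerivWithinAt (fun y : Plane => ((t, y) : ℝ × Plane))
      (ContinuousLinearMap.inr ℝ ℝ Plane) univ x :=
    (hasFDerivAt_prodMk_right t x).hasFDerivWithinAt
  have h2 := (hF.hasFDerivWithinAt ht x).comp x h1 (fun y _ => ⟨ht, mem_univ _⟩)
  exact h2.hasFDerivAt Filter.univ_mem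

theorem SmoothPeriodic.spaceDeriv_eq (hF : SmoothPeriodic L₁ L₂ T F) {t : ℝ}
    (ht : t ∈ Icc 0 T) (x : Plane) (i : Fin 2) : spaceDeriv i F t x
      = fderivWithin ℝ (fun p : ℝ × Plane => F p.1 p.2) (Icc 0 T ×ˢ univ) (t, x) (0, unitVec i) := by
  unfold spaceDeriv
  rw [(hF.hasFDerivAt_space ht x).fderiv]
  simp

theorem SmoothPeriodic.smooth_fderivWithin (hT : 0 < T) (hF : SmoothPeriodic L₁ L₂ T F)
    (v : ℝ × Plane) : ContDiffOn ℝ ∞ (fun p : ℝ × Plane => fderivWithin ℝ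
      (fun p : ℝ × Plane => F p.1 p.2) (Icc 0 T ×ˢ univ) p v) (Icc 0 T ×ˢ univ) :=
  (hF.smooth.fderivWithin (uniqueDiffOn_strip hT) (by simp)).clm_apply contDiffOn_const

theorem SmoothPeriodic.timeDeriv (hT : 0 < T) (hF : SmoothPeriodic L₁ L₂ T F) :
    SmoothPeriodic L₁ L₂ T (timeDeriv T F) where
  smooth := (hF.smooth_fderivWithin hT (1, 0)).congr fun p hp => (hF.timeDeriv_eq hT hp.1 p.2).2
  periodic := fun t ht x =>
    ⟨derivWithin_congr (fun τ hτ => (hF.periodic τ hτ x).1) (hF.periodic t ht x).1,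
      derivWithin_congr (fun τ hτ => (hF.periodic τ hτ x).2) (hF.periodic t ht x).2⟩

theorem SmoothPeriodic.spaceDeriv (hT : 0 < T) (hF : SmoothPeriodic L₁ L₂ T F) (i : Fin 2) :
    SmoothPeriodic L₁ L₂ T (spaceDeriv i F) where
  smooth := (hF.smooth_fderivWithin hT (0, unitVec i)).congr fun p hp =>
    hF.spaceDeriv_eq hp.1 p.2 i
  periodic := fun t ht x => by
    have h : ∀ c, (∀ y, F t (y + c) = F t y) → fderiv ℝ (F t) (x + c) = fderiv ℝ (F t) x := by
      intro c hc
      rw [← fderiv_comp_add_right]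
      congr 1
      funext y
      exact hc y
    unfold NonlocalCH.spaceDeriv
    exact ⟨by rw [h _ fun y => (hF.periodic t ht y).1], by rw [h _ fun y => (hF.periodic t ht y).2]⟩

theorem SmoothPeriodic.iterate_timeDeriv (hT : 0 < T) (hF : SmoothPeriodic L₁ L₂ T F) (k : ℕ) :
    SmoothPeriodic L₁ L₂ T ((NonlocalCH.timeDeriv T)^[k] F) := by
  induction k with
  | zero => exact hF
  | succ k ih => rw [Function.iterate_succ_apply']; exact ih.timeDeriv hT

theorem SmoothPeriodic.iterate_spaceDeriv (hT : 0 < T) (hF : SmoothPeriodic L₁ L₂ T F)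
    (i : Fin 2) (k : ℕ) : SmoothPeriodic L₁ L₂ T ((NonlocalCH.spaceDeriv i)^[k] F) := by
  induction k with
  | zero => exact hF
  | succ k ih => rw [Function.iterate_succ_apply']; exact ih.spaceDeriv hT i

theorem SmoothPeriodic.pow (hF : SmoothPeriodic L₁ L₂ T F) (k : ℕ) :
    SmoothPeriodic L₁ L₂ T (fun t x => F t x ^ k) where
  smooth := hF.smooth.pow k
  periodic := fun t ht x => by
    simp only [(hF.periodic t ht x).1, (hF.periodic t ht x).2, and_self]

theorem smoothPeriodic_const {f : Plane → ℝ} (hf : ContDiff ℝ ∞ f) (hp : IsPeriodic L₁ L₂ f) :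
    SmoothPeriodic L₁ L₂ T (fun _ => f) where
  smooth := (hf.comp contDiff_snd).contDiffOn
  periodic := fun _ _ => hp

theorem SmoothPeriodic.contDiff (hF : SmoothPeriodic L₁ L₂ T F) {t : ℝ} (ht : t ∈ Icc 0 T) :
    ContDiff ℝ ∞ (F t) := by
  rw [← contDiffOn_univ]
  exact hF.smooth.comp (contDiff_prodMk_right t).contDiffOn fun x _ => ⟨ht, mem_univ _⟩

theorem SmoothPeriodic.hasDerivAt_line (hF : SmoothPeriodic L₁ L₂ T F) {t : ℝ}
    (ht : t ∈ Icc 0 T) (x : Plane) (i : Fin 2) (r : ℝ) :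
    HasDerivAt (fun r : ℝ => F t (x + r • unitVec i))
      (NonlocalCH.spaceDeriv i F t (x + r • unitVec i)) r := by
  have h1 : HasFDerivAt (F t) (fderiv ℝ (F t) (x + r • unitVec i)) (x + r • unitVec i) :=
    (((hF.contDiff ht).differentiable (by simp)) _).hasFDerivAt
  have h2 : HasDerivAt (fun r : ℝ => x + r • unitVec i) (unitVec i) r := by
    simpa using ((hasDerivAt_id r).smul_const (unitVec i)).const_add x
  exact h1.comp_hasDerivAt r h2

/-- Taylor's formula along a coordinate line, with a remainder uniform in space and time. -/
theorem SmoothPeriodic.exists_line_taylor (hL₁ : 0 < L₁) (hL₂ : 0 < L₂) (hT : 0 < T)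
    (hF : SmoothPeriodic L₁ L₂ T F) (i : Fin 2) (N : ℕ) :
    ∃ K, ∀ t ∈ Icc 0 T, ∀ x (r : ℝ), |F t (x + r • unitVec i)
      - ∑ k ∈ Finset.range N, r ^ k / (k.factorial : ℝ) * (NonlocalCH.spaceDeriv i)^[k] F t x|
        ≤ K * |r| ^ N := by
  obtain ⟨K, hK⟩ := (hF.iterate_spaceDeriv hT i N).exists_bound hL₁ hL₂
  refine ⟨K, fun t ht x r => ?_⟩
  have := abs_taylor_remainder_le (W := K) convex_univ (mem_univ (0 : ℝ)) (mem_univ r) N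
    (fun k r => (NonlocalCH.spaceDeriv i)^[k] F t (x + r • unitVec i))
    (fun k _ r _ => by
      rw [Function.iterate_succ_apply']
      exact ((hF.iterate_spaceDeriv hT i k).hasDerivAt_line ht x i r).hasDerivWithinAt)
    (fun r _ => hK t ht _)
  simpa using this

end SmoothPeriodic

/-! ### Bounds on difference quotients up to the second order -/

/-- `K` bounds `f` and its difference quotients of first and second order along the axes. -/
def DiffBound (K : ℝ) (f : Plane → ℝ) : Prop :=
  ∀ x, |f x| ≤ K ∧ ∀ (i : Fin 2) (r : ℝ), |f (x + r • unitVec i) - f x| ≤ K * |r| ∧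
    |f (x + r • unitVec i) + f (x - r • unitVec i) - 2 * f x| ≤ K * r ^ 2

section DiffBound

variable {K K' : ℝ} {f g : Plane → ℝ}

theorem DiffBound.nonneg (hf : DiffBound K f) : 0 ≤ K := (abs_nonneg _).trans (hf 0).1

theorem DiffBound.mono (hf : DiffBound K f) (hK : K ≤ K') : DiffBound K' f := fun x =>
  ⟨(hf x).1.trans hK, fun i r =>
    ⟨((hf x).2 i r).1.trans (mul_le_mul_of_nonneg_right hK (abs_nonneg _)),
      ((hf x).2 i r).2.trans (mul_le_mul_of_nonneg_right hK (sq_nonneg _))⟩⟩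

theorem DiffBound.add (hf : DiffBound K f) (hg : DiffBound K' g) :
    DiffBound (K + K') (fun x => f x + g x) := by
  intro x
  refine ⟨(abs_add_le _ _).trans (add_le_add (hf x).1 (hg x).1), fun i r => ⟨?_, ?_⟩⟩
  · rw [add_sub_add_comm, add_mul]
    exact (abs_add_le _ _).trans (add_le_add ((hf x).2 i r).1 ((hg x).2 i r).1)
  · have e : f (x + r • unitVec i) + g (x + r • unitVec i)
        + (f (x - r • unitVec i) + g (x - r • unitVec i)) - 2 * (f x + g x)
        = (f (x + r • unitVec i) + f (x - r • unitVec i) - 2 * f x)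
        + (g (x + r • unitVec i) + g (x - r • unitVec i) - 2 * g x) := by ring
    rw [e, add_mul]
    exact (abs_add_le _ _).trans (add_le_add ((hf x).2 i r).2 ((hg x).2 i r).2)

theorem DiffBound.const_mul (hf : DiffBound K f) (c : ℝ) :
    DiffBound (|c| * K) (fun x => c * f x) := by
  intro x
  have e : ∀ a B : ℝ, |a| ≤ B → |c * a| ≤ |c| * B := fun a B h => by
    rw [abs_mul]; exact mul_le_mul_of_nonneg_left h (abs_nonneg _)
  refine ⟨e _ _ (hf x).1, fun i r => ⟨?_, ?_⟩⟩
  · rw [← mul_sub, mul_assoc]; exact e _ _ ((hf x).2 i r).1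
  · rw [mul_assoc]
    refine le_trans (le_of_eq ?_) (e _ _ ((hf x).2 i r).2)
    congr 1; ring

theorem DiffBound.sub (hf : DiffBound K f) (hg : DiffBound K' g) :
    DiffBound (K + K') (fun x => f x - g x) := by
  have := hf.add (hg.const_mul (-1))
  simpa [sub_eq_add_neg] using this

/-- The second difference obeys a discrete Leibniz rule: each factor's second difference times the
other factor, plus the products of first differences in both directions. -/
theorem DiffBound.mul (hf : DiffBound K f) (hg : DiffBound K' g) :
    DiffBound (4 * (K * K')) (fun x => f x * g x) := by
  have hK := hf.nonneg
  have hK' := hg.nonneg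
  have hKK : 0 ≤ K * K' := mul_nonneg hK hK'
  have mm : ∀ a b A B : ℝ, |a| ≤ A → |b| ≤ B → |a * b| ≤ A * B := fun a b A B ha hb => by
    rw [abs_mul]; exact mul_le_mul ha hb (abs_nonneg _) ((abs_nonneg _).trans ha)
  intro x
  refine ⟨(mm _ _ _ _ (hf x).1 (hg x).1).trans (by linarith), fun i r => ⟨?_, ?_⟩⟩
  · have e : f (x + r • unitVec i) * g (x + r • unitVec i) - f x * g x
        = f (x + r • unitVec i) * (g (x + r • unitVec i) - g x)
          + (f (x + r • unitVec i) - f x) * g x := by ring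
    rw [e]
    refine (abs_add_le _ _).trans ((add_le_add (mm _ _ _ _ (hf _).1 ((hg x).2 i r).1)
      (mm _ _ _ _ ((hf x).2 i r).1 (hg x).1)).trans ?_)
    nlinarith [mul_nonneg hKK (abs_nonneg r)]
  · have e : f (x + r • unitVec i) * g (x + r • unitVec i)
        + f (x - r • unitVec i) * g (x - r • unitVec i) - 2 * (f x * g x)
        = (f x * (g (x + r • unitVec i) + g (x - r • unitVec i) - 2 * g x)
          + (f (x + r • unitVec i) + f (x - r • unitVec i) - 2 * f x) * g x)
        + ((f (x + r • unitVec i) - f x) * (g (x + r • unitVec i) - g x)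
          + (f (x + (-r) • unitVec i) - f x) * (g (x + (-r) • unitVec i) - g x)) := by
      rw [neg_smul, ← sub_eq_add_neg]; ring
    rw [e]
    refine (abs_add_le _ _).trans ((add_le_add ((abs_add_le _ _).trans (add_le_add
      (mm _ _ _ _ (hf x).1 ((hg x).2 i r).2) (mm _ _ _ _ ((hf x).2 i r).2 (hg x).1)))
      ((abs_add_le _ _).trans (add_le_add
      (mm _ _ _ _ ((hf x).2 i r).1 ((hg x).2 i r).1)
      (mm _ _ _ _ ((hf x).2 i (-r)).1 ((hg x).2 i (-r)).1)))).trans (le_of_eq ?_))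
    rw [abs_neg]
    have : |r| * |r| = r ^ 2 := by rw [← sq, sq_abs]
    linear_combination 2 * K * K' * this

theorem DiffBound.comp_sub_left (hf : DiffBound K f) (z : Plane) :
    DiffBound K (fun y => f (z - y)) := by
  intro x
  refine ⟨(hf _).1, fun i r => ⟨?_, ?_⟩⟩
  · have := ((hf (z - x)).2 i (-r)).1
    rw [abs_neg] at this
    convert this using 4
    rw [neg_smul]; abel
  · have := ((hf (z - x)).2 i r).2
    have e1 : z - (x + r • unitVec i) = z - x - r • unitVec i := by abel
    have e2 : z - (x - r • unitVec i) = z - x + r • unitVec i := by abel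
    beta_reduce
    rwa [e1, e2, add_comm (f (z - x - r • unitVec i))]

end DiffBound

section SmoothPeriodic

variable {L₁ L₂ T : ℝ} {F : ℝ → Plane → ℝ}

theorem SmoothPeriodic.exists_diffBound (hL₁ : 0 < L₁) (hL₂ : 0 < L₂) (hT : 0 < T)
    (hF : SmoothPeriodic L₁ L₂ T F) : ∃ K, ∀ t ∈ Icc 0 T, DiffBound K (F t) := by
  obtain ⟨K₀, h₀⟩ := hF.exists_bound hL₁ hL₂
  choose K₁ h₁ using fun i => hF.exists_line_taylor hL₁ hL₂ hT i 1
  choose K₂ h₂ using fun i => hF.exists_line_taylor hL₁ hL₂ hT i 2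
  refine ⟨|K₀| + (|K₁ 0| + |K₁ 1|) + 2 * (|K₂ 0| + |K₂ 1|), fun t ht x => ⟨?_, fun i r => ⟨?_, ?_⟩⟩⟩
  · refine (h₀ t ht x).trans ((le_abs_self _).trans ?_)
    have : 0 ≤ (|K₁ 0| + |K₁ 1|) + 2 * (|K₂ 0| + |K₂ 1|) := by positivity
    linarith
  · have h := h₁ i t ht x r
    simp at h
    refine h.trans (mul_le_mul_of_nonneg_right ((le_abs_self _).trans ?_) (abs_nonneg _))
    have a0 := abs_nonneg (K₁ 0)
    have a1 := abs_nonneg (K₁ 1)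
    have : 0 ≤ |K₀| + 2 * (|K₂ 0| + |K₂ 1|) := by positivity
    fin_cases i <;> simp <;> linarith
  · have h := h₂ i t ht x r
    have h' := h₂ i t ht x (-r)
    simp [Finset.sum_range_succ] at h h'
    rw [← sub_eq_add_neg] at h'
    have e : |F t (x + r • unitVec i) + F t (x - r • unitVec i) - 2 * F t x|
        ≤ 2 * |K₂ i| * r ^ 2 := by
      have := mul_le_mul_of_nonneg_right (le_abs_self (K₂ i)) (sq_nonneg r)
      rw [abs_le] at *
      constructor <;> linarith [h.1, h.2, h'.1, h'.2]
    refine e.trans (mul_le_mul_of_nonneg_right ?_ (sq_nonneg _))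
    have a0 := abs_nonneg (K₂ 0)
    have a1 := abs_nonneg (K₂ 1)
    have : 0 ≤ |K₀| + (|K₁ 0| + |K₁ 1|) := by positivity
    fin_cases i <;> simp <;> linarith

/-- Taylor's formula in time, with a remainder whose spatial difference quotients are bounded. -/
theorem SmoothPeriodic.exists_time_taylor (hL₁ : 0 < L₁) (hL₂ : 0 < L₂) (hT : 0 < T)
    (hF : SmoothPeriodic L₁ L₂ T F) (N : ℕ) :
    ∃ K, ∀ a ∈ Icc 0 T, ∀ b ∈ Icc 0 T, DiffBound (K * |b - a| ^ N) (fun x => F b x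
      - ∑ k ∈ Finset.range N, (b - a) ^ k / (k.factorial : ℝ)
        * (NonlocalCH.timeDeriv T)^[k] F a x) := by
  obtain ⟨K, hK⟩ := (hF.iterate_timeDeriv hT N).exists_diffBound hL₁ hL₂ hT
  -- Values and first and second spatial differences are all combinations of at most three point
  -- values. Such a combination of remainders is the remainder of the combination, so Taylor's
  -- formula in time applies to it and no commutation of mixed derivatives is needed.
  have key : ∀ a ∈ Icc 0 T, ∀ b ∈ Icc 0 T, ∀ (c : Fin 3 → ℝ) (y : Fin 3 → Plane) (W : ℝ),
      (∀ τ ∈ Icc 0 T, |∑ j, c j * (NonlocalCH.timeDeriv T)^[N] F τ (y j)| ≤ W) →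
      |∑ j, c j * (F b (y j) - ∑ k ∈ Finset.range N, (b - a) ^ k / (k.factorial : ℝ)
        * (NonlocalCH.timeDeriv T)^[k] F a (y j))| ≤ W * |b - a| ^ N := by
    intro a ha b hb c y W hW
    have := abs_taylor_remainder_le (convex_Icc 0 T) ha hb N
      (fun k τ => ∑ j, c j * (NonlocalCH.timeDeriv T)^[k] F τ (y j))
      (fun k _ τ hτ => HasDerivWithinAt.fun_sum fun j _ => by
        rw [Function.iterate_succ_apply']
        exact ((hF.iterate_timeDeriv hT k).timeDeriv_eq hT hτ (y j)).1.const_mul (c j)) hW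
    convert this using 2
    simp only [mul_sub, Finset.sum_sub_distrib, Finset.mul_sum, Function.iterate_zero, id]
    congr 1
    rw [Finset.sum_comm]
    refine Finset.sum_congr rfl fun k _ => Finset.sum_congr rfl fun j _ => by ring
  refine ⟨K, fun a ha b hb x => ⟨?_, fun i r => ⟨?_, ?_⟩⟩⟩
  · have := key a ha b hb ![1, 0, 0] ![x, x, x] K (fun τ hτ => by
      simpa [Fin.sum_univ_three] using (hK τ hτ x).1)
    simpa [Fin.sum_univ_three] using this
  · have := key a ha b hb ![1, -1, 0] ![x + r • unitVec i, x, x] (K * |r|) (fun τ hτ => by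
      simpa [Fin.sum_univ_three, sub_eq_add_neg] using ((hK τ hτ x).2 i r).1)
    refine le_trans (le_of_eq ?_) (this.trans (le_of_eq (by ring)))
    simp [Fin.sum_univ_three, sub_eq_add_neg]
  · have := key a ha b hb ![1, 1, -2] ![x + r • unitVec i, x - r • unitVec i, x] (K * r ^ 2)
      (fun τ hτ => by
        simpa [Fin.sum_univ_three, sub_eq_add_neg] using ((hK τ hτ x).2 i r).2)
    refine le_trans (le_of_eq ?_) (this.trans (le_of_eq (by ring)))
    simp only [Fin.sum_univ_three]
    congr 1
    simp
    ring

end SmoothPeriodic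

/-! ### Quadrature of periodic functions -/

theorem sum_Icc_eq_sum_range (m : ℕ) (g : ℤ → ℝ) :
    ∑ k ∈ Finset.Icc (1 : ℤ) m, g k = ∑ k ∈ Finset.range m, g (k + 1) := by
  symm
  refine Finset.sum_bij (fun k _ => (k : ℤ) + 1) ?_ ?_ ?_ ?_
  · intro k hk; simp only [Finset.mem_range, Finset.mem_Icc] at *; omega
  · intro i _ j _ h; simpa using h
  · intro j hj
    simp only [Finset.mem_Icc] at hj
    exact ⟨(j - 1).toNat, by simp only [Finset.mem_range]; omega, by omega⟩
  · intros; rfl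

theorem abs_integral_cell_sub_le {f : ℝ → ℝ} (hc : Continuous f) {K h : ℝ} (hh : 0 < h)
    (hK : ∀ x r, |f (x + r) + f (x - r) - 2 * f x| ≤ K * r ^ 2) (c : ℝ) :
    |(∫ x in (c - h / 2)..(c + h / 2), f x) - h * f c| ≤ K * h ^ 2 * h := by
  have hK0 : 0 ≤ K := by simpa using (abs_nonneg _).trans (hK 0 1)
  have e1 : ∫ x in (c - h / 2)..(c + h / 2), f x = ∫ z in (-(h / 2))..(h / 2), f (c + z) := by
    rw [intervalIntegral.integral_comp_add_left]; rfl
  have e2 : ∫ x in (c - h / 2)..(c + h / 2), f x = ∫ z in (-(h / 2))..(h / 2), f (c - z) := by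
    rw [intervalIntegral.integral_comp_sub_left]; simp
  have i1 : IntervalIntegrable (fun z => f (c + z)) volume (-(h / 2)) (h / 2) :=
    (by fun_prop : Continuous fun z => f (c + z)).intervalIntegrable _ _
  have i2 : IntervalIntegrable (fun z => f (c - z)) volume (-(h / 2)) (h / 2) :=
    (by fun_prop : Continuous fun z => f (c - z)).intervalIntegrable _ _
  -- Averaging the substitutions c + z and c − z leaves only the symmetric second difference, which
  -- is O(z²).
  have e3 : ∫ z in (-(h / 2))..(h / 2), (f (c + z) + f (c - z) - 2 * f c)
      = 2 * ((∫ x in (c - h / 2)..(c + h / 2), f x) - h * f c) := by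
    rw [intervalIntegral.integral_sub (i1.add i2) intervalIntegrable_const,
      intervalIntegral.integral_add i1 i2, ← e1, ← e2, intervalIntegral.integral_const]
    simp only [smul_eq_mul]; ring
  have b := intervalIntegral.norm_integral_le_of_norm_le_const (a := -(h / 2)) (b := h / 2)
    (f := fun z => f (c + z) + f (c - z) - 2 * f c) (C := K * h ^ 2) (fun z hz => by
      rw [uIoc_of_le (by linarith)] at hz
      refine (hK c z).trans (mul_le_mul_of_nonneg_left ?_ hK0)
      exact sq_le_sq' (by linarith [hz.1]) (by linarith [hz.2]))
  rw [e3, Real.norm_eq_abs, abs_mul, abs_two, show h / 2 - -(h / 2) = h by ring,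
    abs_of_pos hh] at b
  linarith [abs_nonneg ((∫ x in (c - h / 2)..(c + h / 2), f x) - h * f c)]

theorem abs_integral_sub_sum_le {f : ℝ → ℝ} (hc : Continuous f) {K h : ℝ} (hh : 0 < h) {m : ℕ}
    (hp : Function.Periodic f (m * h))
    (hK : ∀ x r, |f (x + r) + f (x - r) - 2 * f x| ≤ K * r ^ 2) :
    |(∫ x in (0 : ℝ)..(m * h), f x) - h * ∑ k ∈ Finset.Icc (1 : ℤ) m, f (k * h)|
      ≤ m * h * (K * h ^ 2) := by
  have e1 : ∫ x in (0 : ℝ)..(m * h), f x = ∑ k ∈ Finset.range m,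
      ∫ x in (((k : ℕ) : ℝ) + 1 / 2) * h..(((k + 1 : ℕ) : ℝ) + 1 / 2) * h, f x := by
    rw [intervalIntegral.sum_integral_adjacent_intervals (a := fun k : ℕ => ((k : ℝ) + 1 / 2) * h)
      fun k _ => hc.intervalIntegrable _ _]
    -- By periodicity the interval may be moved by h/2. The nodes kh then become midpoints of cells,
    -- and the rectangle rule becomes the midpoint rule.
    have := hp.intervalIntegral_add_eq 0 (1 / 2 * h)
    rw [zero_add] at this
    rw [this]
    congr 1 <;> simp
    ring
  rw [e1, sum_Icc_eq_sum_range, Finset.mul_sum, ← Finset.sum_sub_distrib]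
  refine (Finset.abs_sum_le_sum_abs _ _).trans ?_
  have : ∀ k ∈ Finset.range m,
      |(∫ x in (((k : ℕ) : ℝ) + 1 / 2) * h..(((k + 1 : ℕ) : ℝ) + 1 / 2) * h, f x)
        - h * f (((k : ℤ) + 1 : ℤ) * h)| ≤ K * h ^ 2 * h := by
    intro k _
    have := abs_integral_cell_sub_le hc hh hK ((k + 1) * h)
    convert this using 4
    · ring
    · push_cast; ring
    · push_cast; ring
  refine (Finset.sum_le_sum this).trans (le_of_eq ?_)
  simp
  ring

/-- The identification of the plane with `ℝ × ℝ`. -/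
def planeEquiv : ℝ × ℝ ≃ᵐ Plane :=
  (MeasurableEquiv.finTwoArrow (α := ℝ)).symm.trans (MeasurableEquiv.toLp 2 (Fin 2 → ℝ))

theorem planeEquiv_apply (p : ℝ × ℝ) : planeEquiv p = !₂[p.1, p.2] := rfl

theorem measurePreserving_planeEquiv : MeasurePreserving planeEquiv volume volume :=
  (PiLp.volume_preserving_toLp (Fin 2)).comp ((volume_preserving_finTwoArrow ℝ).symm _)

theorem planeEquiv_preimage_rect (L₁ L₂ : ℝ) :
    planeEquiv ⁻¹' rect L₁ L₂ = Ioo 0 L₁ ×ˢ Ioo 0 L₂ := by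
  ext p; simp [planeEquiv_apply, rect]

theorem volume_rect_lt_top (L₁ L₂ : ℝ) : volume (rect L₁ L₂) < ⊤ := by
  rw [← measurePreserving_planeEquiv.measure_preimage_equiv, planeEquiv_preimage_rect]
  exact ((Metric.isBounded_Ioo 0 L₁).prod (Metric.isBounded_Ioo 0 L₂)).measure_lt_top

theorem continuous_vec₂ {X : Type*} [TopologicalSpace X] {f g : X → ℝ} (hf : Continuous f)
    (hg : Continuous g) : Continuous fun x => (!₂[f x, g x] : Plane) := by
  refine (PiLp.continuous_toLp 2 _).comp (continuous_pi fun i => ?_)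
  fin_cases i
  · exact hf
  · exact hg

theorem integral_rect {L₁ L₂ : ℝ} (hL₁ : 0 ≤ L₁) (hL₂ : 0 ≤ L₂) {f : Plane → ℝ}
    (hf : Continuous f) : ∫ y in rect L₁ L₂, f y
      = ∫ a in (0 : ℝ)..L₁, ∫ b in (0 : ℝ)..L₂, f !₂[a, b] := by
  rw [← measurePreserving_planeEquiv.setIntegral_preimage_emb planeEquiv.measurableEmbedding,
    planeEquiv_preimage_rect, Measure.volume_eq_prod, setIntegral_prod]
  · simp only [planeEquiv_apply, intervalIntegral.integral_of_le hL₁,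
      intervalIntegral.integral_of_le hL₂, integral_Ioc_eq_integral_Ioo]
  · have hc : Continuous fun p : ℝ × ℝ => f (planeEquiv p) :=
      hf.comp (continuous_vec₂ continuous_fst continuous_snd)
    rw [← Measure.volume_eq_prod]
    exact (hc.continuousOn.integrableOn_compact (isCompact_Icc.prod isCompact_Icc)).mono_set
      (prod_mono Ioo_subset_Icc_self Ioo_subset_Icc_self)

theorem vec₂_add_smul_zero (a b r : ℝ) :
    (!₂[a, b] : Plane) + r • unitVec 0 = !₂[a + r, b] := by
  ext i; fin_cases i <;> simp [unitVec]

theorem vec₂_add_smul_one (a b r : ℝ) :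
    (!₂[a, b] : Plane) + r • unitVec 1 = !₂[a, b + r] := by
  ext i; fin_cases i <;> simp [unitVec]

theorem vec₂_sub_smul_zero (a b r : ℝ) :
    (!₂[a, b] : Plane) - r • unitVec 0 = !₂[a - r, b] := by
  ext i; fin_cases i <;> simp [unitVec]

theorem vec₂_sub_smul_one (a b r : ℝ) :
    (!₂[a, b] : Plane) - r • unitVec 1 = !₂[a, b - r] := by
  ext i; fin_cases i <;> simp [unitVec]

theorem IsPeriodic.vec₂ {L₁ L₂ : ℝ} {f : Plane → ℝ} (hf : IsPeriodic L₁ L₂ f) (a b : ℝ) :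
    f !₂[a + L₁, b] = f !₂[a, b] ∧ f !₂[a, b + L₂] = f !₂[a, b] := by
  have e1 : (!₂[a + L₁, b] : Plane) = !₂[a, b] + !₂[L₁, 0] := by
    ext i; fin_cases i <;> simp
  have e2 : (!₂[a, b + L₂] : Plane) = !₂[a, b] + !₂[0, L₂] := by
    ext i; fin_cases i <;> simp
  rw [e1, e2]
  exact hf _

/-- The rectangle rule is of second order for periodic functions. -/
theorem abs_integral_rect_sub_gridSum_le {L₁ L₂ : ℝ} {m n : ℕ} {h K : ℝ}
    (hg : IsGrid L₁ L₂ m n h) {f : Plane → ℝ} (hf : Continuous f) (hp : IsPeriodic L₁ L₂ f)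
    (hK : DiffBound K f) :
    |(∫ y in rect L₁ L₂, f y) - gridSum m n h (fun k l => f !₂[k * h, l * h])|
      ≤ 2 * (L₁ * L₂) * K * h ^ 2 := by
  have hh := hg.h_pos
  have hL₁ : 0 ≤ L₁ := by rw [hg.L₁_eq]; positivity
  have hL₂ : 0 ≤ L₂ := by rw [hg.L₂_eq]; positivity
  have hc₂ : ∀ a, Continuous fun b => f !₂[a, b] := fun a =>
    hf.comp (continuous_vec₂ continuous_const continuous_id)
  have hint : ∀ a, IntervalIntegrable (fun b => f !₂[a, b]) volume 0 L₂ := fun a =>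
    (hc₂ a).intervalIntegrable _ _
  set g : ℝ → ℝ := fun a => ∫ b in (0 : ℝ)..L₂, f !₂[a, b] with hgd
  have hgc : Continuous g :=
    intervalIntegral.continuous_parametric_intervalIntegral_of_continuous'
      (f := fun a b => f !₂[a, b]) (hf.comp (continuous_vec₂ continuous_fst continuous_snd)) 0 L₂
  have hgK : ∀ a r, |g (a + r) + g (a - r) - 2 * g a| ≤ (K * L₂) * r ^ 2 := by
    intro a r
    have e : g (a + r) + g (a - r) - 2 * g a = ∫ b in (0 : ℝ)..L₂,
        (f !₂[a + r, b] + f !₂[a - r, b] - 2 * f !₂[a, b]) := by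
      rw [intervalIntegral.integral_sub ((hint _).add (hint _)) ((hint _).const_mul 2),
        intervalIntegral.integral_add (hint _) (hint _), intervalIntegral.integral_const_mul]
    rw [e, ← Real.norm_eq_abs]
    refine (intervalIntegral.norm_integral_le_of_norm_le_const (C := K * r ^ 2)
      fun b _ => ?_).trans (le_of_eq ?_)
    · have := ((hK !₂[a, b]).2 0 r).2
      rwa [vec₂_add_smul_zero, vec₂_sub_smul_zero] at this
    · rw [sub_zero, abs_of_nonneg hL₂]; ring
  have hgp : Function.Periodic g (m * h) := fun a => by
    rw [← hg.L₁_eq]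
    simp only [hgd, (hp.vec₂ _ _).1]
  have q1 := abs_integral_sub_sum_le hgc hh hgp hgK
  have q2 : ∀ k : ℤ, |g (k * h) - h * ∑ l ∈ Finset.Icc (1 : ℤ) n, f !₂[k * h, l * h]|
      ≤ L₂ * (K * h ^ 2) := by
    intro k
    have := abs_integral_sub_sum_le (hc₂ (k * h)) hh (m := n) (K := K)
      (fun b => by rw [← hg.L₂_eq]; exact (hp.vec₂ _ _).2)
      (fun b r => by
        have := ((hK !₂[k * h, b]).2 1 r).2
        rwa [vec₂_add_smul_one, vec₂_sub_smul_one] at this)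
    rwa [← hg.L₂_eq] at this
  rw [integral_rect hL₁ hL₂ hf]
  have q3 : |h * ∑ k ∈ Finset.Icc (1 : ℤ) m, g (k * h)
      - gridSum m n h (fun k l => f !₂[k * h, l * h])| ≤ L₁ * (L₂ * (K * h ^ 2)) := by
    have e : h * ∑ k ∈ Finset.Icc (1 : ℤ) m, g (k * h)
        - gridSum m n h (fun k l => f !₂[k * h, l * h])
        = h * ∑ k ∈ Finset.Icc (1 : ℤ) m,
          (g (k * h) - h * ∑ l ∈ Finset.Icc (1 : ℤ) n, f !₂[k * h, l * h]) := by
      rw [Finset.sum_sub_distrib, ← Finset.mul_sum, gridSum]; ring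
    rw [e, abs_mul, abs_of_pos hh]
    refine (mul_le_mul_of_nonneg_left ((Finset.abs_sum_le_sum_abs _ _).trans
      (Finset.sum_le_sum fun k _ => q2 k)) hh.le).trans (le_of_eq ?_)
    rw [Finset.sum_const, Int.card_Icc, nsmul_eq_mul, hg.L₁_eq]
    simp
    ring
  rw [← hg.L₁_eq] at q1
  have := abs_sub_le (∫ a in (0 : ℝ)..L₁, g a) (h * ∑ k ∈ Finset.Icc (1 : ℤ) m, g (k * h))
    (gridSum m n h (fun k l => f !₂[k * h, l * h]))
  linarith

/-! ### The Laplacian of the chemical potential -/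

theorem laplacian_of_hasFDerivAt {f : Plane → ℝ} {f' : Plane → Plane →L[ℝ] ℝ}
    {f'' : Plane →L[ℝ] Plane →L[ℝ] ℝ} {x : Plane} (h₁ : ∀ y, HasFDerivAt f (f' y) y)
    (h₂ : HasFDerivAt f' f'' x) :
    Laplacian.laplacian f x = ∑ i, f'' (unitVec i) (unitVec i) := by
  rw [laplacian_eq_iteratedFDeriv_orthonormalBasis f (EuclideanSpace.basisFun (Fin 2) ℝ)]
  refine Finset.sum_congr rfl fun i _ => ?_
  rw [iteratedFDeriv_two_apply]
  have : fderiv ℝ f = f' := funext fun y => (h₁ y).fderiv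
  rw [this, h₂.fderiv]
  simp [unitVec]

theorem integrable_rect_smul {E : Type*} [NormedAddCommGroup E] [NormedSpace ℝ E] (L₁ L₂ : ℝ)
    {J : Plane → ℝ} (hJ : Continuous J) {A B : ℝ} (hA : ∀ x, |J x| ≤ A) {f : Plane → E}
    (hf : Continuous f) (hB : ∀ x, ‖f x‖ ≤ B) (x : Plane) :
    Integrable (fun y => J y • f (x - y)) (volume.restrict (rect L₁ L₂)) := by
  have fin : IsFiniteMeasure (volume.restrict (rect L₁ L₂)) :=
    ⟨by rw [Measure.restrict_apply_univ]; exact volume_rect_lt_top L₁ L₂⟩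
  refine Integrable.of_bound (C := A * B) (Continuous.aestronglyMeasurable (by fun_prop)) ?_
  refine Filter.Eventually.of_forall fun y => ?_
  rw [norm_smul]
  exact mul_le_mul (hA y) (hB _) (norm_nonneg _) ((abs_nonneg _).trans (hA 0))

/-- Differentiation under the integral sign in a convolution over the rectangle. -/
theorem hasFDerivAt_integral_rect {E : Type*} [NormedAddCommGroup E] [NormedSpace ℝ E]
    (L₁ L₂ : ℝ) {J : Plane → ℝ} (hJ : Continuous J) {A B : ℝ} (hA : ∀ x, |J x| ≤ A)
    {f : Plane → E} {f' : Plane → Plane →L[ℝ] E} (hf : ∀ x, HasFDerivAt f (f' x) x)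
    (hf' : Continuous f') (hB₀ : ∀ x, ‖f x‖ ≤ B) (hB : ∀ x, ‖f' x‖ ≤ B) (x : Plane) :
    HasFDerivAt (fun x => ∫ y in rect L₁ L₂, J y • f (x - y))
      (∫ y in rect L₁ L₂, J y • f' (x - y)) x := by
  have hfc : Continuous f := continuous_iff_continuousAt.2 fun x => (hf x).continuousAt
  have fin : IsFiniteMeasure (volume.restrict (rect L₁ L₂)) :=
    ⟨by rw [Measure.restrict_apply_univ]; exact volume_rect_lt_top L₁ L₂⟩
  have hA0 : 0 ≤ A := (abs_nonneg _).trans (hA 0)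
  have bd : ∀ (x y : Plane), ‖J y • f' (x - y)‖ ≤ A * B := fun x y => by
    rw [norm_smul]
    exact mul_le_mul (hA y) (hB _) (norm_nonneg _) hA0
  refine hasFDerivAt_integral_of_dominated_of_fderiv_le (F' := fun x y => J y • f' (x - y))
    (bound := fun _ => A * B) Filter.univ_mem ?_ ?_ ?_ ?_ (integrable_const _) ?_
  · refine Filter.Eventually.of_forall fun x => Continuous.aestronglyMeasurable ?_
    fun_prop
  · exact integrable_rect_smul L₁ L₂ hJ hA hfc hB₀ x
  · exact Continuous.aestronglyMeasurable (by fun_prop)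
  · exact Filter.Eventually.of_forall fun y x _ => bd x y
  · refine Filter.Eventually.of_forall fun y x _ => ?_
    exact ((hf (x - y)).comp x ((hasFDerivAt_id x).sub_const y)).const_smul (J y)

/-- The sum of the pure second spatial derivatives of `F`. -/
def spaceLaplacian (F : ℝ → Plane → ℝ) : ℝ → Plane → ℝ :=
  fun t x => ∑ i, spaceDeriv i (spaceDeriv i F) t x

theorem spaceLaplacian_eq {F : ℝ → Plane → ℝ} {t : ℝ} (hF : ContDiff ℝ ∞ (F t)) (x : Plane) :
    spaceLaplacian F t x
      = ∑ i, fderiv ℝ (fderiv ℝ (F t)) x (unitVec i) (unitVec i) := by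
  refine Finset.sum_congr rfl fun i _ => ?_
  have h1 : ContDiff ℝ ∞ (fderiv ℝ (F t)) := hF.fderiv_right (by simp)
  have h2 : HasFDerivAt (fderiv ℝ (F t)) (fderiv ℝ (fderiv ℝ (F t)) x) x :=
    ((h1.differentiable (by simp)) x).hasFDerivAt
  have h3 := (ContinuousLinearMap.apply ℝ ℝ (unitVec i)).hasFDerivAt.comp x h2
  change fderiv ℝ (fun y => fderiv ℝ (F t) y (unitVec i)) x (unitVec i) = _
  exact congrArg (fun L => L (unitVec i)) h3.fderiv

theorem exists_norm_bound_plane {E : Type*} [NormedAddCommGroup E] {L₁ L₂ : ℝ} (hL₁ : 0 < L₁)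
    (hL₂ : 0 < L₂) {f : Plane → E} (hc : Continuous f)
    (hp : ∀ x, f (x + !₂[L₁, 0]) = f x ∧ f (x + !₂[0, L₂]) = f x) : ∃ K, ∀ x, ‖f x‖ ≤ K := by
  -- The degenerate interval [0, 0] reduces the time-dependent bound to a single function.
  obtain ⟨K, hK⟩ := exists_norm_bound (T := 0) (F := fun _ => f) hL₁ hL₂
    (hc.comp continuous_snd).continuousOn (fun _ _ => hp)
  exact ⟨K, hK 0 (by simp)⟩

theorem fderiv_periodic {E : Type*} [NormedAddCommGroup E] [NormedSpace ℝ E] {f : Plane → E}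
    {c : Plane} (hp : ∀ x, f (x + c) = f x) (x : Plane) :
    fderiv ℝ f (x + c) = fderiv ℝ f x := by
  rw [← fderiv_comp_add_right]
  congr 1
  funext y
  exact hp y

/-- The Laplacian of the chemical potential of a smooth periodic function. -/
theorem laplacian_chemicalPotential (P : Model) (hP : P.Admissible) {F : ℝ → Plane → ℝ} {t : ℝ}
    (hF : ContDiff ℝ ∞ (F t)) (hp : IsPeriodic P.L₁ P.L₂ (F t)) (x : Plane) :
    Laplacian.laplacian (P.chemicalPotential (F t)) x
      = spaceLaplacian (fun t x => F t x ^ 3) t x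
        + (P.γc - P.γe + P.mass P.J) * spaceLaplacian F t x
        - ∫ y in rect P.L₁ P.L₂, P.J y * spaceLaplacian F t (x - y) := by
  have hF3 : ContDiff ℝ ∞ (fun x => F t x ^ 3) := hF.pow 3
  have hF' : ContDiff ℝ ∞ (fderiv ℝ (F t)) := hF.fderiv_right (by simp)
  have hF'' : ContDiff ℝ ∞ (fderiv ℝ (fderiv ℝ (F t))) := hF'.fderiv_right (by simp)
  have hF3' : ContDiff ℝ ∞ (fderiv ℝ (fun x => F t x ^ 3)) := hF3.fderiv_right (by simp)
  have hp' : ∀ x, fderiv ℝ (F t) (x + !₂[P.L₁, 0]) = fderiv ℝ (F t) x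
      ∧ fderiv ℝ (F t) (x + !₂[0, P.L₂]) = fderiv ℝ (F t) x := fun x =>
    ⟨fderiv_periodic (fun y => (hp y).1) x, fderiv_periodic (fun y => (hp y).2) x⟩
  obtain ⟨B₀, hB₀⟩ := exists_norm_bound_plane hP.L₁_pos hP.L₂_pos hF.continuous hp
  obtain ⟨B₁, hB₁⟩ := exists_norm_bound_plane hP.L₁_pos hP.L₂_pos hF'.continuous hp'
  obtain ⟨B₂, hB₂⟩ := exists_norm_bound_plane hP.L₁_pos hP.L₂_pos hF''.continuous fun x =>
    ⟨fderiv_periodic (fun y => (hp' y).1) x, fderiv_periodic (fun y => (hp' y).2) x⟩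
  have hJc : Continuous P.J := hP.Jc_smooth.continuous.sub hP.Je_smooth.continuous
  obtain ⟨A, hA⟩ := exists_norm_bound_plane hP.L₁_pos hP.L₂_pos hJc fun x => by
    simp only [Model.J, (hP.Jc_periodic x).1, (hP.Je_periodic x).1, (hP.Jc_periodic x).2,
      (hP.Je_periodic x).2, and_self]
  set c := P.γc - P.γe + P.mass P.J with hc
  have e : P.chemicalPotential (F t) = fun x => F t x ^ 3 + c * F t x
      - ∫ y in rect P.L₁ P.L₂, P.J y • F t (x - y) := by
    funext x
    simp only [Model.chemicalPotential, Model.conv, Model.domain, hc, smul_eq_mul]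
    ring
  have d : ∀ {E : Type} [NormedAddCommGroup E] [NormedSpace ℝ E] {f : Plane → E},
      ContDiff ℝ ∞ f → ∀ y, HasFDerivAt f (fderiv ℝ f y) y := fun hf y =>
    ((hf.differentiable (by simp)) y).hasFDerivAt
  have h₁ : ∀ y, HasFDerivAt (P.chemicalPotential (F t))
      (fderiv ℝ (fun x => F t x ^ 3) y + c • fderiv ℝ (F t) y
        - ∫ z in rect P.L₁ P.L₂, P.J z • fderiv ℝ (F t) (y - z)) y := by
    intro y
    rw [e]
    exact ((d hF3 y).add ((d hF y).const_mul c)).sub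
      (hasFDerivAt_integral_rect P.L₁ P.L₂ hJc hA (B := max B₀ B₁) (d hF) hF'.continuous
        (fun x => (hB₀ x).trans (le_max_left _ _)) (fun x => (hB₁ x).trans (le_max_right _ _)) y)
  have h₂ : HasFDerivAt (fun y => fderiv ℝ (fun x => F t x ^ 3) y + c • fderiv ℝ (F t) y
        - ∫ z in rect P.L₁ P.L₂, P.J z • fderiv ℝ (F t) (y - z))
      (fderiv ℝ (fderiv ℝ (fun x => F t x ^ 3)) x + c • fderiv ℝ (fderiv ℝ (F t)) x
        - ∫ z in rect P.L₁ P.L₂, P.J z • fderiv ℝ (fderiv ℝ (F t)) (x - z)) x :=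
    ((d hF3' x).add ((d hF' x).const_smul c)).sub
      (hasFDerivAt_integral_rect P.L₁ P.L₂ hJc hA (B := max B₁ B₂) (d hF') hF''.continuous
        (fun x => (hB₁ x).trans (le_max_left _ _)) (fun x => (hB₂ x).trans (le_max_right _ _)) x)
  have hint := integrable_rect_smul P.L₁ P.L₂ hJc hA hF''.continuous hB₂ x
  have hi : ∀ i, (∫ z in rect P.L₁ P.L₂, P.J z • fderiv ℝ (fderiv ℝ (F t)) (x - z))
      (unitVec i) (unitVec i) = ∫ z in rect P.L₁ P.L₂,
        P.J z * fderiv ℝ (fderiv ℝ (F t)) (x - z) (unitVec i) (unitVec i) := by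
    intro i
    rw [ContinuousLinearMap.integral_apply hint,
      ContinuousLinearMap.integral_apply (hint.apply_continuousLinearMap _)]
    rfl
  have hint2 : ∀ i, Integrable (fun z => P.J z
      * fderiv ℝ (fderiv ℝ (F t)) (x - z) (unitVec i) (unitVec i))
      (volume.restrict (rect P.L₁ P.L₂)) := fun i =>
    (hint.apply_continuousLinearMap (unitVec i)).apply_continuousLinearMap (unitVec i)
  rw [laplacian_of_hasFDerivAt h₁ h₂, spaceLaplacian_eq hF3, spaceLaplacian_eq hF]
  simp only [spaceLaplacian_eq hF, Finset.mul_sum]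
  rw [integral_finsetSum _ fun i _ => hint2 i, ← Finset.sum_add_distrib, ← Finset.sum_sub_distrib]
  refine Finset.sum_congr rfl fun i _ => ?_
  rw [← hi]
  rfl

/-! ### The discrete Laplacian on functions of the plane -/

/-- The five-point Laplacian of mesh size `h`, applied to a function of the plane. -/
def planeLaplacian (h : ℝ) (f : Plane → ℝ) (x : Plane) : ℝ :=
  (∑ i, (f (x + h • unitVec i) + f (x - h • unitVec i) - 2 * f x)) / h ^ 2

theorem cellRestrict_add (h : ℝ) (f : Plane → ℝ) (i j k l : ℤ) :
    cellRestrict h f (i + k) (j + l) = f (!₂[gridPt h i, gridPt h j] + !₂[k * h, l * h]) := by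
  unfold cellRestrict gridPt
  congr 1
  ext a; fin_cases a <;> simp <;> ring

theorem gridLaplacian_cellRestrict (h : ℝ) (f : Plane → ℝ) (i j : ℤ) :
    gridLaplacian h (cellRestrict h f) i j = planeLaplacian h f !₂[gridPt h i, gridPt h j] := by
  unfold gridLaplacian planeLaplacian
  have e1 := cellRestrict_add h f i j 1 0
  have e2 := cellRestrict_add h f i j (-1) 0
  have e3 := cellRestrict_add h f i j 0 1
  have e4 := cellRestrict_add h f i j 0 (-1)
  have v1 : (!₂[((1 : ℤ) : ℝ) * h, ((0 : ℤ) : ℝ) * h] : Plane) = h • unitVec 0 := by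
    ext a; fin_cases a <;> simp [unitVec]
  have v2 : (!₂[((-1 : ℤ) : ℝ) * h, ((0 : ℤ) : ℝ) * h] : Plane) = -(h • unitVec 0) := by
    ext a; fin_cases a <;> simp [unitVec]
  have v3 : (!₂[((0 : ℤ) : ℝ) * h, ((1 : ℤ) : ℝ) * h] : Plane) = h • unitVec 1 := by
    ext a; fin_cases a <;> simp [unitVec]
  have v4 : (!₂[((0 : ℤ) : ℝ) * h, ((-1 : ℤ) : ℝ) * h] : Plane) = -(h • unitVec 1) := by
    ext a; fin_cases a <;> simp [unitVec]
  rw [v1] at e1; rw [v2] at e2; rw [v3] at e3; rw [v4] at e4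
  simp only [add_zero, ← sub_eq_add_neg] at e1 e2 e3 e4
  rw [e1, e2, e3, e4, Fin.sum_univ_two]
  unfold cellRestrict
  ring

theorem abs_planeLaplacian_le {h K : ℝ} (hh : 0 < h) {f : Plane → ℝ} (hf : DiffBound K f)
    (x : Plane) : |planeLaplacian h f x| ≤ 2 * K := by
  unfold planeLaplacian
  rw [abs_div, abs_of_pos (show 0 < h ^ 2 by positivity), div_le_iff₀ (by positivity),
    Fin.sum_univ_two]
  refine (abs_add_le _ _).trans ?_
  linarith [((hf x).2 0 h).2, ((hf x).2 1 h).2]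

theorem planeLaplacian_add (h : ℝ) (f g : Plane → ℝ) (x : Plane) :
    planeLaplacian h (fun x => f x + g x) x = planeLaplacian h f x + planeLaplacian h g x := by
  simp only [planeLaplacian, Fin.sum_univ_two]; ring

theorem planeLaplacian_sub (h : ℝ) (f g : Plane → ℝ) (x : Plane) :
    planeLaplacian h (fun x => f x - g x) x = planeLaplacian h f x - planeLaplacian h g x := by
  simp only [planeLaplacian, Fin.sum_univ_two]; ring

theorem planeLaplacian_const_mul (h c : ℝ) (f : Plane → ℝ) (x : Plane) :
    planeLaplacian h (fun x => c * f x) x = c * planeLaplacian h f x := by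
  simp only [planeLaplacian, Fin.sum_univ_two]; ring

/-- The five-point Laplacian commutes with discrete convolution. It can thus be replaced by the
exact Laplacian before the quadrature rule is applied to a smooth integrand. -/
theorem planeLaplacian_gridSum {m n : ℕ} (h : ℝ) (J : GridFun) (v : ℤ → ℤ → Plane)
    (f : Plane → ℝ) (x : Plane) :
    planeLaplacian h (fun x => gridSum m n h (fun k l => J k l * f (x - v k l))) x
      = gridSum m n h (fun k l => J k l * planeLaplacian h f (x - v k l)) := by
  have e : (fun k l => J k l * planeLaplacian h f (x - v k l)) = fun k l => (h ^ 2)⁻¹ *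
      ((J k l * f (x + h • unitVec 0 - v k l) + J k l * f (x - h • unitVec 0 - v k l)
        - 2 * (J k l * f (x - v k l)))
      + (J k l * f (x + h • unitVec 1 - v k l) + J k l * f (x - h • unitVec 1 - v k l)
        - 2 * (J k l * f (x - v k l)))) := by
    funext k l
    simp only [planeLaplacian, Fin.sum_univ_two, add_sub_right_comm x, sub_right_comm x]
    ring
  rw [e, gridSum_smul, gridSum_add, gridSum_sub, gridSum_sub, gridSum_add, gridSum_add,
    gridSum_smul, planeLaplacian, Fin.sum_univ_two]
  ring

theorem SmoothPeriodic.exists_planeLaplacian_bound {L₁ L₂ T : ℝ} {F : ℝ → Plane → ℝ}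
    (hL₁ : 0 < L₁) (hL₂ : 0 < L₂) (hT : 0 < T) (hF : SmoothPeriodic L₁ L₂ T F) :
    ∃ K, ∀ t ∈ Icc 0 T, ∀ x, ∀ h > 0,
      |planeLaplacian h (F t) x - spaceLaplacian F t x| ≤ K * h ^ 2 := by
  -- Order four is needed because of the division by h²; the odd terms cancel between the steps h
  -- and −h.
  choose K hK using fun i => hF.exists_line_taylor hL₁ hL₂ hT i 4
  refine ⟨2 * (K 0 + K 1), fun t ht x h hh => ?_⟩
  have key : ∀ i, |F t (x + h • unitVec i) + F t (x - h • unitVec i) - 2 * F t x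
      - h ^ 2 * NonlocalCH.spaceDeriv i (NonlocalCH.spaceDeriv i F) t x| ≤ 2 * K i * h ^ 4 := by
    intro i
    have h1 := hK i t ht x h
    have h2 := hK i t ht x (-h)
    simp only [Finset.sum_range_succ, Finset.sum_range_zero, neg_smul, ← sub_eq_add_neg, abs_neg,
      abs_of_pos hh, Function.iterate_succ, Function.iterate_zero, Function.comp, id] at h1 h2
    simp [Nat.factorial] at h1 h2
    rw [abs_le] at *
    constructor <;> linarith [h1.1, h1.2, h2.1, h2.2]
  have e : planeLaplacian h (F t) x - spaceLaplacian F t x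
      = ((F t (x + h • unitVec 0) + F t (x - h • unitVec 0) - 2 * F t x
        - h ^ 2 * NonlocalCH.spaceDeriv 0 (NonlocalCH.spaceDeriv 0 F) t x)
      + (F t (x + h • unitVec 1) + F t (x - h • unitVec 1) - 2 * F t x
        - h ^ 2 * NonlocalCH.spaceDeriv 1 (NonlocalCH.spaceDeriv 1 F) t x)) / h ^ 2 := by
    simp only [planeLaplacian, spaceLaplacian, Fin.sum_univ_two]
    field_simp
    ring
  rw [e, abs_div, abs_of_pos (show 0 < h ^ 2 by positivity), div_le_iff₀ (by positivity)]
  refine (abs_add_le _ _).trans ((add_le_add (key 0) (key 1)).trans (le_of_eq (by ring)))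

/-! ### Consistency of the scheme -/

/-- With c = (a + b)/2 and d = (b − a)/2 one has η(a, b) = c³ + c d². Here d = O(s), and c³ − f³
contains the factor c − f = O(s²). Each closeness is measured in `DiffBound`, so the discrete
Laplacian of the result is O(s²) uniformly in h. -/
theorem DiffBound.eta_sub_pow {K s : ℝ} (hK : 1 ≤ K) {a b f : Plane → ℝ}
    (ha : DiffBound K a) (hb : DiffBound K b) (hf : DiffBound K f)
    (hd : DiffBound (K * s) (fun x => b x - a x))
    (hm : DiffBound (K * s ^ 2) (fun x => 1 / 2 * (a x + b x) - f x)) :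
    DiffBound (64 * K ^ 3 * s ^ 2) (fun x => eta (a x) (b x) - f x ^ 3) := by
  have hc : DiffBound K (fun x => 1 / 2 * (a x + b x)) := by
    have := (ha.add hb).const_mul (1 / 2)
    refine this.mono (le_of_eq ?_)
    rw [abs_of_pos (by norm_num)]; ring
  have h1 := hm.mul (((hc.mul hc).add (hc.mul hf)).add (hf.mul hf))
  have h2 := hc.mul ((hd.const_mul (1 / 2)).mul (hd.const_mul (1 / 2)))
  have e : (fun x => eta (a x) (b x) - f x ^ 3) = fun x =>
      (1 / 2 * (a x + b x) - f x) * (1 / 2 * (a x + b x) * (1 / 2 * (a x + b x))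
        + 1 / 2 * (a x + b x) * f x + f x * f x)
      + 1 / 2 * (a x + b x) * (1 / 2 * (b x - a x) * (1 / 2 * (b x - a x))) := by
    funext x; unfold eta; ring
  rw [e]
  refine (h1.add h2).mono ?_
  rw [abs_of_pos (by norm_num : (0 : ℝ) < 1 / 2)]
  have : 0 ≤ K ^ 3 * s ^ 2 := by positivity
  nlinarith

/-- The discrete convolution of grid values `J` with a function of the plane. -/
def semiConv (m n : ℕ) (h : ℝ) (J : GridFun) (f : Plane → ℝ) (x : Plane) : ℝ :=
  gridSum m n h (fun k l => J k l * f (x - !₂[k * h, l * h]))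

theorem gridConv_cellRestrict (m n : ℕ) (h : ℝ) (J : GridFun) (f : Plane → ℝ) :
    gridConv m n h J (cellRestrict h f) = cellRestrict h (semiConv m n h J f) := by
  funext i j
  rw [gridConv_eq_gridSum]
  unfold cellRestrict semiConv gridPt
  congr 1
  funext k l
  congr 2
  ext a; fin_cases a <;> simp <;> ring

theorem abs_semiConv_le {m n : ℕ} {h L₁ L₂ A B : ℝ} (hg : IsGrid L₁ L₂ m n h) {J : GridFun}
    {f : Plane → ℝ} (hJ : ∀ k l, |J k l| ≤ A) (hf : ∀ x, |f x| ≤ B) (x : Plane) :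
    |semiConv m n h J f x| ≤ L₁ * L₂ * (A * B) := by
  refine (abs_gridSum_le _).trans ?_
  rw [← gridSum_const hg]
  refine gridSum_mono fun k l => ?_
  rw [abs_mul]
  exact mul_le_mul (hJ k l) (hf _) (abs_nonneg _) ((abs_nonneg _).trans (hJ k l))

theorem semiConv_sub (m n : ℕ) (h : ℝ) (J : GridFun) (f g : Plane → ℝ) (x : Plane) :
    semiConv m n h J (fun x => f x - g x) x = semiConv m n h J f x - semiConv m n h J g x := by
  simp only [semiConv, mul_sub, gridSum_sub]

/-- The discrete Laplacian of the discrete potential of functions close to `f` is close to the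
Laplacian of the chemical potential of `f`. -/
theorem abs_planeLaplacian_potential_sub_le {m n : ℕ} {h s K ρ bc be γ L₁ L₂ l₃ I : ℝ}
    (hg : IsGrid L₁ L₂ m n h) (hA : 0 ≤ L₁ * L₂) (hK : 1 ≤ K) {J : GridFun}
    (hJ : ∀ k l, |J k l| ≤ K) (hbc : |bc| ≤ K) (hbe : |be| ≤ K) (hγ : |bc - be| ≤ K)
    {a b f E l : Plane → ℝ} {x : Plane}
    (hη : DiffBound (K * s ^ 2) (fun x => eta (a x) (b x) - f x ^ 3))
    (hm : DiffBound (K * s ^ 2) (fun x => 1 / 2 * (a x + b x) - f x))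
    (hE : DiffBound ρ (fun x => E x - f x))
    (hl₃ : |planeLaplacian h (fun x => f x ^ 3) x - l₃| ≤ K * h ^ 2)
    (hl : ∀ y, |planeLaplacian h f y - l y| ≤ K * h ^ 2) (hlK : ∀ y, |l y| ≤ K)
    (hbb : |bc - be - γ| ≤ K * h ^ 2) (hI : |semiConv m n h J l x - I| ≤ K * h ^ 2) :
    |planeLaplacian h (fun x => eta (a x) (b x) + bc * (1 / 2 * (a x + b x)) - be * E x
        - semiConv m n h J E x) x - (l₃ + γ * l x - I)|
      ≤ (5 + L₁ * L₂) * K ^ 2 * (h ^ 2 + s ^ 2) + (2 + 2 * (L₁ * L₂)) * K * ρ := by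
  have hh := hg.h_pos
  have hρ := hE.nonneg
  have mm : ∀ {a b A B : ℝ}, |a| ≤ A → |b| ≤ B → |a * b| ≤ A * B := fun {a b A B} ha hb => by
    rw [abs_mul]; exact mul_le_mul ha hb (abs_nonneg _) ((abs_nonneg _).trans ha)
  have sc : ∀ g : Plane → ℝ, planeLaplacian h (semiConv m n h J g) x
      = semiConv m n h J (planeLaplacian h g) x := fun g =>
    planeLaplacian_gridSum h J (fun k l => !₂[k * h, l * h]) g x
  have eW : planeLaplacian h (fun x => eta (a x) (b x) + bc * (1 / 2 * (a x + b x)) - be * E x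
        - semiConv m n h J E x) x
      = planeLaplacian h (fun x => eta (a x) (b x)) x
        + bc * planeLaplacian h (fun x => 1 / 2 * (a x + b x)) x
        - be * planeLaplacian h E x - semiConv m n h J (planeLaplacian h E) x := by
    rw [planeLaplacian_sub, planeLaplacian_sub, planeLaplacian_add,
      planeLaplacian_const_mul h bc, planeLaplacian_const_mul h be, ← sc E]
  have t1 := abs_planeLaplacian_le hh hη x
  have t2 := mm hbc (abs_planeLaplacian_le hh hm x)
  have t3 := mm hbe (abs_planeLaplacian_le hh hE x)
  have t4 := abs_semiConv_le hg hJ (abs_planeLaplacian_le hh hE) x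
  have t5 := abs_semiConv_le hg hJ hl x
  have t6 := mm hγ (hl x)
  have t7 := mm hbb (hlK x)
  have e4 : planeLaplacian h (fun x => E x - f x)
      = fun x => planeLaplacian h E x - planeLaplacian h f x :=
    funext fun y => planeLaplacian_sub h E f y
  rw [e4, semiConv_sub] at t4
  rw [semiConv_sub] at t5
  rw [planeLaplacian_sub] at t1 t2 t3
  rw [eW]
  have hKK : K ≤ K ^ 2 := by nlinarith
  have z1 := mul_le_mul_of_nonneg_right hKK (sq_nonneg h)
  have z2 := mul_le_mul_of_nonneg_right hKK (sq_nonneg s)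
  have z3 : 0 ≤ L₁ * L₂ * (K ^ 2 * s ^ 2) := by positivity
  have z4 : 0 ≤ K ^ 2 * s ^ 2 := by positivity
  rw [abs_le] at *
  constructor <;>
  linarith [t1.1, t1.2, t2.1, t2.2, t3.1, t3.2, t4.1, t4.2, t5.1, t5.2, t6.1, t6.2, t7.1, t7.2,
    hI.1, hI.2, hl₃.1, hl₃.2]

/-! ### Second-order differences in time about the half step. -/

section Time

variable {L₁ L₂ T : ℝ} {F : ℝ → Plane → ℝ}

/-- Finite differences in time of a smooth periodic function. -/
theorem SmoothPeriodic.exists_time_differences (hL₁ : 0 < L₁) (hL₂ : 0 < L₂) (hT : 0 < T)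
    (hF : SmoothPeriodic L₁ L₂ T F) : ∃ K, ∀ t s, 0 ≤ t → 0 < s → t + s ≤ T →
      DiffBound (K * s) (fun x => F (t + s) x - F t x) ∧
      DiffBound (K * s) (fun x => F t x - F (t + s / 2) x) ∧
      DiffBound (K * s ^ 2) (fun x => 1 / 2 * (F t x + F (t + s) x) - F (t + s / 2) x) ∧
      (s ≤ t → DiffBound (K * s ^ 2)
        (fun x => 3 / 2 * F t x - 1 / 2 * F (t - s) x - F (t + s / 2) x)) ∧
      ∀ x, |F (t + s) x - F t x - s * NonlocalCH.timeDeriv T F (t + s / 2) x|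
        ≤ K * (s * s ^ 2) := by
  obtain ⟨K₁, h₁⟩ := hF.exists_time_taylor hL₁ hL₂ hT 1
  obtain ⟨K₂, h₂⟩ := hF.exists_time_taylor hL₁ hL₂ hT 2
  obtain ⟨K₃, h₃⟩ := hF.exists_time_taylor hL₁ hL₂ hT 3
  simp only [Finset.sum_range_succ, Finset.sum_range_zero, pow_zero, pow_one, zero_add,
    Nat.factorial_zero, Nat.factorial_one, Nat.cast_one, div_one, one_mul, Function.iterate_zero,
    Function.iterate_one, id] at h₁ h₂ h₃
  refine ⟨|K₁| + 2 * |K₂| + |K₃|, fun t s ht hs hts => ?_⟩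
  have a1 := abs_nonneg K₁
  have a2 := abs_nonneg K₂
  have a3 := abs_nonneg K₃
  have m0 : t ∈ Icc 0 T := ⟨ht, by linarith⟩
  have m1 : t + s / 2 ∈ Icc 0 T := ⟨by linarith, by linarith⟩
  have m2 : t + s ∈ Icc 0 T := ⟨by linarith, hts⟩
  have w1 : K₁ * s ≤ |K₁| * s := mul_le_mul_of_nonneg_right (le_abs_self _) hs.le
  have w2 : K₂ * s ^ 2 ≤ |K₂| * s ^ 2 := mul_le_mul_of_nonneg_right (le_abs_self _) (sq_nonneg _)
  have w3 : K₃ * s ^ 3 ≤ |K₃| * s ^ 3 := mul_le_mul_of_nonneg_right (le_abs_self _) (by positivity)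
  have p1 := mul_nonneg a1 hs.le
  have p2 := mul_nonneg a2 hs.le
  have p3 := mul_nonneg a3 hs.le
  have q1 := mul_nonneg a1 (sq_nonneg s)
  have q2 := mul_nonneg a2 (sq_nonneg s)
  have q3 := mul_nonneg a3 (sq_nonneg s)
  have c1 : t + s - (t + s / 2) = s / 2 := by ring
  have c2 : t - (t + s / 2) = -(s / 2) := by ring
  have c3 : t - s - (t + s / 2) = -(3 / 2 * s) := by ring
  have b1 : |s / 2| = s / 2 := abs_of_pos (by linarith)
  refine ⟨?_, ?_, ?_, ?_, ?_⟩
  · refine (h₁ t m0 (t + s) m2).mono ?_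
    rw [add_sub_cancel_left, abs_of_pos hs]
    linarith
  · refine (h₁ _ m1 t m0).mono ?_
    rw [c2, abs_neg, b1]
    linarith
  · have := ((h₂ _ m1 t m0).add (h₂ _ m1 _ m2)).const_mul (1 / 2)
    rw [c1, c2, abs_neg, b1, abs_of_pos (by norm_num : (0 : ℝ) < 1 / 2)] at this
    refine DiffBound.mono (K := 1 / 2 * (K₂ * (s / 2) ^ 2 + K₂ * (s / 2) ^ 2)) ?_ ?_
    · convert this using 2
      ring
    · linarith
  · intro hst
    have m3 : t - s ∈ Icc 0 T := ⟨by linarith, by linarith⟩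
    have := ((h₂ _ m1 t m0).const_mul (3 / 2)).sub ((h₂ _ m1 _ m3).const_mul (1 / 2))
    rw [c2, c3, abs_neg, abs_neg, b1, abs_of_pos (by norm_num : (0 : ℝ) < 1 / 2),
      abs_of_pos (by norm_num : (0 : ℝ) < 3 / 2), abs_of_pos (by linarith : 0 < 3 / 2 * s)] at this
    refine DiffBound.mono
      (K := 3 / 2 * (K₂ * (s / 2) ^ 2) + 1 / 2 * (K₂ * (3 / 2 * s) ^ 2)) ?_ ?_
    · convert this using 2
      ring
    · linarith
  · intro x
    have r1 := (h₃ _ m1 _ m2 x).1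
    have r2 := (h₃ _ m1 t m0 x).1
    rw [c1, b1] at r1
    rw [c2, abs_neg, b1] at r2
    have p2' := mul_nonneg p2 (sq_nonneg s)
    have p1' := mul_nonneg p1 (sq_nonneg s)
    have p3' := mul_nonneg p3 (sq_nonneg s)
    rw [abs_le] at *
    constructor <;> nlinarith [r1.1, r1.2, r2.1, r2.2]

end Time

/-! ### Grid restrictions and the truncation error of the exact solution. -/

theorem IsPeriodic.add_int_mul {L₁ L₂ : ℝ} {f : Plane → ℝ} (hf : IsPeriodic L₁ L₂ f)
    (a b : ℝ) (p q : ℤ) : f !₂[a + p * L₁, b + q * L₂] = f !₂[a, b] := by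
  have p1 : Function.Periodic (fun a => f !₂[a, b + q * L₂]) L₁ := fun a => (hf.vec₂ _ _).1
  have p2 : Function.Periodic (fun b => f !₂[a, b]) L₂ := fun b => (hf.vec₂ _ _).2
  exact (p1.int_mul p a).trans (p2.int_mul q b)

theorem isGridPeriodic_cellRestrict {L₁ L₂ h : ℝ} {m n : ℕ} (hg : IsGrid L₁ L₂ m n h)
    {f : Plane → ℝ} (hf : IsPeriodic L₁ L₂ f) : IsGridPeriodic m n (cellRestrict h f) := by
  intro i j p q
  unfold cellRestrict
  rw [← hf.add_int_mul (gridPt h i) (gridPt h j) p q, hg.L₁_eq, hg.L₂_eq]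
  congr 1
  ext a; fin_cases a <;> simp [gridPt] <;> ring

theorem vertexRestrict_apply (h : ℝ) (f : Plane → ℝ) (k l : ℤ) :
    vertexRestrict h f k l = f !₂[k * h, l * h] := by
  unfold vertexRestrict gridPt
  simp

theorem isGridPeriodic_vertexRestrict {L₁ L₂ h : ℝ} {m n : ℕ} (hg : IsGrid L₁ L₂ m n h)
    {f : Plane → ℝ} (hf : IsPeriodic L₁ L₂ f) : IsGridPeriodic m n (vertexRestrict h f) := by
  intro i j p q
  rw [vertexRestrict_apply, vertexRestrict_apply,
    ← hf.add_int_mul (i * h) (j * h) p q, hg.L₁_eq, hg.L₂_eq]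
  congr 1
  ext a; fin_cases a <;> simp <;> ring

theorem abs_gridMass_le {L₁ L₂ h K : ℝ} {m n : ℕ} (hg : IsGrid L₁ L₂ m n h) {f : GridFun}
    (hf : ∀ k l, |f k l| ≤ K) : |gridMass m n h f| ≤ L₁ * L₂ * K := by
  refine (abs_gridSum_le f).trans ?_
  rw [← gridSum_const hg]
  exact gridSum_mono hf

theorem discretePotential_cellRestrict (P : Model) (m n : ℕ) (h : ℝ) {Ψ : ℕ → GridFun} {k : ℕ}
    {a b E : Plane → ℝ} (ha : Ψ k = cellRestrict h a) (hb : Ψ (k + 1) = cellRestrict h b)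
    (hE : extrapLevel Ψ k = cellRestrict h E) :
    P.discretePotential m n h Ψ k = cellRestrict h (fun x => eta (a x) (b x)
      + P.Bc m n h * (1 / 2 * (a x + b x)) - P.Be m n h * E x
      - semiConv m n h (vertexRestrict h P.J) E x) := by
  funext i j
  unfold Model.discretePotential midLevel
  rw [hE, gridConv_cellRestrict, ha, hb]
  rfl

theorem Model.Admissible.J_smooth {P : Model} (hP : P.Admissible) : ContDiff ℝ ∞ P.J :=
  hP.Jc_smooth.sub hP.Je_smooth

theorem Model.Admissible.J_periodic {P : Model} (hP : P.Admissible) :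
    IsPeriodic P.L₁ P.L₂ P.J := fun x => by
  simp only [Model.J, (hP.Jc_periodic x).1, (hP.Je_periodic x).1, (hP.Jc_periodic x).2,
      (hP.Je_periodic x).2, and_self]

theorem Bc_sub_Be (P : Model) (m n : ℕ) (h : ℝ) :
    P.Bc m n h - P.Be m n h = gridMass m n h (vertexRestrict h P.J) + (P.γc - P.γe) := by
  have : gridMass m n h (vertexRestrict h P.J)
      = gridMass m n h (vertexRestrict h P.Jc) - gridMass m n h (vertexRestrict h P.Je) :=
    gridSum_sub _ _
  rw [this]
  unfold Model.Bc Model.Be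
  ring

/-- The residual of the exact solution in the scheme, for a general extrapolation `E`. -/
theorem exists_residual_bound (P : Model) (hP : P.Admissible) {T : ℝ} (hT : 0 < T)
    {Φ : ℝ → Plane → ℝ} (hΦ : P.IsSmoothSolution T Φ) :
    ∃ K, 1 ≤ K ∧ ∀ (m n : ℕ) (h s t ρ : ℝ) (E : Plane → ℝ), IsGrid P.L₁ P.L₂ m n h →
      0 ≤ t → 0 < s → t + s ≤ T → DiffBound ρ (fun x => E x - Φ (t + s / 2) x) → ∀ x,
      |Φ (t + s) x - Φ t x - s * planeLaplacian h (fun x => eta (Φ t x) (Φ (t + s) x)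
        + P.Bc m n h * (1 / 2 * (Φ t x + Φ (t + s) x)) - P.Be m n h * E x
        - semiConv m n h (vertexRestrict h P.J) E x) x|
      ≤ s * ((6 + P.L₁ * P.L₂) * K ^ 2 * (h ^ 2 + s ^ 2)
        + (2 + 2 * (P.L₁ * P.L₂)) * K * ρ) := by
  have hL₁ := hP.L₁_pos
  have hL₂ := hP.L₂_pos
  set A := P.L₁ * P.L₂ with hA
  have hA0 : 0 < A := mul_pos hL₁ hL₂
  have hF : SmoothPeriodic P.L₁ P.L₂ T Φ := ⟨hΦ.smooth, hΦ.periodic⟩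
  have hJp := hP.J_periodic
  have mem0 : (0 : ℝ) ∈ Icc 0 T := ⟨le_rfl, hT.le⟩
  obtain ⟨K₀, h₀⟩ := hF.exists_diffBound hL₁ hL₂ hT
  obtain ⟨Kj, hj⟩ := (smoothPeriodic_const (T := T) hP.J_smooth hJp).exists_diffBound hL₁ hL₂ hT
  obtain ⟨Ke, he⟩ := (smoothPeriodic_const (T := T) hP.Je_smooth hP.Je_periodic).exists_bound hL₁ hL₂
  obtain ⟨Kt, ht⟩ := hF.exists_time_differences hL₁ hL₂ hT
  obtain ⟨Kd, hd⟩ := hF.exists_planeLaplacian_bound hL₁ hL₂ hT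
  obtain ⟨Kd₃, hd₃⟩ := (hF.pow 3).exists_planeLaplacian_bound hL₁ hL₂ hT
  obtain ⟨Ka, ha⟩ := ((hF.spaceDeriv hT 0).spaceDeriv hT 0).exists_diffBound hL₁ hL₂ hT
  obtain ⟨Kb, hb⟩ := ((hF.spaceDeriv hT 1).spaceDeriv hT 1).exists_diffBound hL₁ hL₂ hT
  obtain ⟨M, hM⟩ : ∃ M, M = 1 + |K₀| + |Kj| + |Ke| + |Kt| + |Kd| + |Kd₃| + (|Ka| + |Kb|)
    + P.γc + P.γe := ⟨_, rfl⟩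
  have hγc := hP.γc_nonneg
  have hγe := hP.γe_nonneg
  have n0 := abs_nonneg K₀
  have n1 := abs_nonneg Kj
  have n2 := abs_nonneg Ke
  have n3 := abs_nonneg Kt
  have n4 := abs_nonneg Kd
  have n5 := abs_nonneg Kd₃
  have n6 := abs_nonneg Ka
  have n7 := abs_nonneg Kb
  have hM1 : 1 ≤ M := by linarith
  have hM2 : M ≤ M ^ 2 := by nlinarith
  have hM3 : M ^ 2 ≤ M ^ 3 := by nlinarith [sq_nonneg M]
  have hKj : Kj ≤ M - (P.γc + P.γe) := by linarith [le_abs_self Kj]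
  have hKe : Ke ≤ M - P.γe := by linarith [le_abs_self Ke]
  -- One constant dominates everything: 64 M³ comes from the cubic term, and multiples of A M and A
  -- M² come from the coefficients and the quadrature errors.
  obtain ⟨K, hK⟩ : ∃ K, K = 64 * (1 + A) * M ^ 3 := ⟨_, rfl⟩
  have hAM : 0 ≤ A * M ^ 3 := by positivity
  have hK64 : 64 * M ^ 3 ≤ K := by rw [hK]; linarith
  have hMK : M ≤ K := by linarith
  have hAM' : A * M ≤ A * M ^ 3 := mul_le_mul_of_nonneg_left (by linarith) hA0.le
  have hAM2 : A * M ^ 2 ≤ A * M ^ 3 := mul_le_mul_of_nonneg_left (by linarith) hA0.le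
  have hK1 : M + A * M ≤ K := by rw [hK]; linarith
  refine ⟨K, by linarith, fun m n h s t ρ E hg ht0 hs hts hE x => ?_⟩
  have hh := hg.h_pos
  obtain ⟨td1, -, td3, -, td5⟩ := ht t s ht0 hs hts
  have m0 : t ∈ Icc 0 T := ⟨ht0, by linarith⟩
  have m1 : t + s / 2 ∈ Icc 0 T := ⟨by linarith, by linarith⟩
  have m2 : t + s ∈ Icc 0 T := ⟨by linarith, hts⟩
  have hKt : Kt ≤ M := by linarith [le_abs_self Kt]
  have hK₀ : K₀ ≤ M := by linarith [le_abs_self K₀]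
  have td1' := td1.mono (mul_le_mul_of_nonneg_right hKt hs.le)
  have td3' := td3.mono (mul_le_mul_of_nonneg_right hKt (sq_nonneg s))
  have hη := ((h₀ t m0).mono hK₀).eta_sub_pow hM1 ((h₀ _ m2).mono hK₀) ((h₀ _ m1).mono hK₀)
    td1' td3'
  have hJK : ∀ k l, |vertexRestrict h P.J k l| ≤ Kj := fun k l => by
    rw [vertexRestrict_apply]; exact (hj 0 mem0 _).1
  have hmJ := abs_le.1 (abs_gridMass_le hg hJK)
  have hmJe := abs_le.1 (abs_gridMass_le hg (f := vertexRestrict h P.Je) (K := Ke) fun k l => by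
    rw [vertexRestrict_apply]; exact he 0 mem0 _)
  have hAKj : A * Kj ≤ A * M := mul_le_mul_of_nonneg_left (by linarith) hA0.le
  have hAKe : A * Ke ≤ A * M := mul_le_mul_of_nonneg_left (by linarith) hA0.le
  have hγ' : |P.Bc m n h - P.Be m n h| ≤ A * M + (P.γc + P.γe) := by
    rw [Bc_sub_Be]
    exact abs_le.2 ⟨by linarith only [hmJ.1, hAKj, hγc, hγe], by linarith only [hmJ.2, hAKj, hγe]⟩
  have hbe' : |P.Be m n h| ≤ A * M + P.γe := by
    unfold Model.Be
    exact abs_le.2 ⟨by linarith only [hmJe.1, hAKe, hγe], by linarith only [hmJe.2, hAKe]⟩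
  have hsum : P.γc + P.γe ≤ M := by linarith only [hM, n0, n1, n2, n3, n4, n5, n6, n7]
  have hγ : |P.Bc m n h - P.Be m n h| ≤ K := hγ'.trans (by linarith only [hK1, hsum])
  have hbe : |P.Be m n h| ≤ K := hbe'.trans (by linarith only [hK1, hsum, hγc])
  have hquad : |P.mass P.J - gridMass m n h (vertexRestrict h P.J)| ≤ 2 * A * Kj * h ^ 2 := by
    have := abs_integral_rect_sub_gridSum_le hg hP.J_smooth.continuous hJp (hj 0 mem0)
    simp only [← vertexRestrict_apply] at this
    exact this
  have hbb : |P.Bc m n h - P.Be m n h - (P.γc - P.γe + P.mass P.J)| ≤ K * h ^ 2 := by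
    rw [Bc_sub_Be, show ∀ a b c : ℝ, a + b - (b + c) = -(c - a) by intros; ring, abs_neg]
    refine hquad.trans (mul_le_mul_of_nonneg_right ?_ (sq_nonneg h))
    linarith only [hAKj, hAM', hAM, hK, hM1, hM2, hM3]
  have hlD : DiffBound M (spaceLaplacian Φ (t + s / 2)) := by
    have e : spaceLaplacian Φ (t + s / 2) = fun x =>
        spaceDeriv 0 (spaceDeriv 0 Φ) (t + s / 2) x + spaceDeriv 1 (spaceDeriv 1 Φ) (t + s / 2) x :=
      funext fun x => Fin.sum_univ_two _
    rw [e]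
    exact ((ha _ m1).add (hb _ m1)).mono (by linarith [le_abs_self Ka, le_abs_self Kb])
  have hlp : IsPeriodic P.L₁ P.L₂ (spaceLaplacian Φ (t + s / 2)) := fun x => by
    have p := fun i => ((hF.spaceDeriv hT i).spaceDeriv hT i).periodic _ m1 x
    simp only [spaceLaplacian, (p _).1, (p _).2, and_self]
  have hlc : Continuous (spaceLaplacian Φ (t + s / 2)) :=
    continuous_finsetSum _ fun i _ =>
      (((hF.spaceDeriv hT i).spaceDeriv hT i).contDiff m1).continuous
  have hI : |semiConv m n h (vertexRestrict h P.J) (spaceLaplacian Φ (t + s / 2)) x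
      - ∫ y in rect P.L₁ P.L₂, P.J y * spaceLaplacian Φ (t + s / 2) (x - y)| ≤ K * h ^ 2 := by
    have := abs_integral_rect_sub_gridSum_le hg
      (f := fun y => P.J y * spaceLaplacian Φ (t + s / 2) (x - y))
      (hP.J_smooth.continuous.mul (hlc.comp (continuous_const.sub continuous_id)))
      (fun y => by
        have e : ∀ c, (∀ z, spaceLaplacian Φ (t + s / 2) (z + c)
            = spaceLaplacian Φ (t + s / 2) z) →
            spaceLaplacian Φ (t + s / 2) (x - (y + c)) = spaceLaplacian Φ (t + s / 2) (x - y) := by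
          intro c hc
          rw [← hc (x - (y + c))]
          congr 1
          abel
        simp only [(hJp y).1, (hJp y).2, e _ fun z => (hlp z).1, e _ fun z => (hlp z).2, and_self])
      (((hj 0 mem0).mono (by linarith : Kj ≤ M)).mul (hlD.comp_sub_left x))
    rw [abs_sub_comm]
    simp only [← vertexRestrict_apply h P.J] at this
    refine this.trans (mul_le_mul_of_nonneg_right ?_ (sq_nonneg h))
    linarith only [hAM2, hAM, hK, hM1, hM2, hM3]
  have main := abs_planeLaplacian_potential_sub_le (s := s) (ρ := ρ) hg hA0.le (by linarith : 1 ≤ K)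
    (fun k l => (hJK k l).trans (by linarith)) (bc := P.Bc m n h) (be := P.Be m n h) ?_ hbe hγ
    (hη.mono (mul_le_mul_of_nonneg_right hK64 (sq_nonneg s)))
    (td3'.mono (mul_le_mul_of_nonneg_right hMK (sq_nonneg s))) hE
    ((hd₃ _ m1 x h hh).trans (mul_le_mul_of_nonneg_right
      (by linarith [le_abs_self Kd₃]) (sq_nonneg h)))
    (fun y => (hd _ m1 y h hh).trans (mul_le_mul_of_nonneg_right
      (by linarith [le_abs_self Kd]) (sq_nonneg h)))
    (fun y => (hlD y).1.trans hMK) hbb hI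
  -- The equation is used at the half time, which is positive even in the first step. There the
  -- centred time difference has error O(s² · s), and the discrete potential is compared with the
  -- exact one.
  · have eq := hΦ.equation (t + s / 2) ⟨by linarith, m1.2⟩ x
    rw [laplacian_chemicalPotential P hP (hF.contDiff m1) (hF.periodic _ m1) x] at eq
    have r5 := td5 x
    change timeDeriv T Φ (t + s / 2) x = _ at eq
    rw [eq] at r5
    have main' := mul_le_mul_of_nonneg_left main hs.le
    rw [← abs_of_pos hs, ← abs_mul, abs_of_pos hs] at main'
    have z1 : Kt * (s * s ^ 2) ≤ K ^ 2 * (s * s ^ 2) :=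
      mul_le_mul_of_nonneg_right (by nlinarith only [hKt, hMK, hM1]) (by positivity)
    have z2 : 0 ≤ K ^ 2 * (s * h ^ 2) := by positivity
    obtain ⟨r1, r2⟩ := abs_le.1 r5
    obtain ⟨u1, u2⟩ := abs_le.1 main'
    exact abs_le.2 ⟨by linarith only [r1, u2, z1, z2], by linarith only [r2, u1, z1, z2]⟩
  · have e : P.Bc m n h = (P.Bc m n h - P.Be m n h) + P.Be m n h := by ring
    rw [e]
    refine (abs_add_le _ _).trans ((add_le_add hγ' hbe').trans ?_)
    linarith only [hsum, hγc, hγe, hAM', hK, hM2, hM3, hM1, hAM]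

/-- The grid values of a smooth solution satisfy all hypotheses of the stability theorem. -/
theorem exists_consistency (P : Model) (hP : P.Admissible) {T : ℝ} (hT : 0 < T)
    {Φ : ℝ → Plane → ℝ} (hΦ : P.IsSmoothSolution T Φ) :
    ∃ M, 1 ≤ M ∧ T ≤ M ∧ ∀ (m n : ℕ) (h s : ℝ), IsGrid P.L₁ P.L₂ m n h → 0 < s → s ≤ 1 →
      P.Bc m n h ≤ M ∧
      (∀ k l, |vertexRestrict h P.J (k + 1) l - vertexRestrict h P.J k l| ≤ M * h) ∧
      (∀ k l, |vertexRestrict h P.J k (l + 1) - vertexRestrict h P.J k l| ≤ M * h) ∧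
      ∀ Ψ : ℕ → GridFun, (∀ k, Ψ k = cellRestrict h (Φ (k * s))) →
      (∀ k : ℕ, k * s ≤ T → ∀ i j, |Ψ k i j| ≤ M) ∧
      (∀ k : ℕ, (k + 1 : ℕ) * s ≤ T → ∀ i j, |Ψ (k + 1) i j - Ψ k i j| ≤ M * s) ∧
      (1 * s ≤ T → ∀ i j, |Ψ 1 i j - Ψ 0 i j
        - s * gridLaplacian h (P.discretePotential m n h Ψ 0) i j| ≤ s * (M * (h ^ 2 + s))) ∧
      (∀ k : ℕ, (k + 2 : ℕ) * s ≤ T → ∀ i j, |Ψ (k + 2) i j - Ψ (k + 1) i j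
        - s * gridLaplacian h (P.discretePotential m n h Ψ (k + 1)) i j|
          ≤ s * (M * (h ^ 2 + s ^ 2))) := by
  have hL₁ := hP.L₁_pos
  have hL₂ := hP.L₂_pos
  obtain ⟨A, hA⟩ : ∃ A, A = P.L₁ * P.L₂ := ⟨_, rfl⟩
  have hA0 : 0 < A := hA ▸ mul_pos hL₁ hL₂
  have hF : SmoothPeriodic P.L₁ P.L₂ T Φ := ⟨hΦ.smooth, hΦ.periodic⟩
  have mem0 : (0 : ℝ) ∈ Icc 0 T := ⟨le_rfl, hT.le⟩
  obtain ⟨K₀, h₀⟩ := hF.exists_diffBound hL₁ hL₂ hT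
  obtain ⟨Kj, hj⟩ :=
    (smoothPeriodic_const (T := T) hP.J_smooth hP.J_periodic).exists_diffBound hL₁ hL₂ hT
  obtain ⟨Kc, hc⟩ :=
    (smoothPeriodic_const (T := T) hP.Jc_smooth hP.Jc_periodic).exists_bound hL₁ hL₂
  obtain ⟨Kt, ht⟩ := hF.exists_time_differences hL₁ hL₂ hT
  obtain ⟨K, hK1, hK⟩ := exists_residual_bound P hP hT hΦ
  have hKc0 : 0 ≤ Kc := (abs_nonneg _).trans (hc 0 mem0 0)
  have hγc := hP.γc_nonneg
  have n0 := abs_nonneg K₀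
  have n1 := abs_nonneg Kj
  have n3 := abs_nonneg Kt
  have n4 : 0 ≤ A * Kc := mul_nonneg hA0.le hKc0
  obtain ⟨R, hR⟩ : ∃ R, R = (6 + A) * K ^ 2 + (2 + 2 * A) * K * |Kt| := ⟨_, rfl⟩
  have hR0 : 0 ≤ R := by rw [hR]; positivity
  obtain ⟨M, hM⟩ : ∃ M, M = 1 + T + |K₀| + |Kj| + A * Kc + P.γc + |Kt| + R := ⟨_, rfl⟩
  refine ⟨M, by linarith, by linarith, fun m n h s hg hs hs1 => ?_⟩
  have hh := hg.h_pos
  rw [← hA] at hK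
  have hKM : ∀ r : ℝ, 0 ≤ r → K₀ * r ≤ M * r := fun r hr =>
    mul_le_mul_of_nonneg_right (by linarith [le_abs_self K₀]) hr
  -- The parameter `r` is the order of the extrapolation: `s` in the first step and `s ^ 2`
  -- afterwards.
  have final : ∀ (t ρ r : ℝ) (E : Plane → ℝ), 0 ≤ t → t + s ≤ T → s ^ 2 ≤ r → ρ ≤ |Kt| * r →
      DiffBound ρ (fun x => E x - Φ (t + s / 2) x) → ∀ (Ψ : ℕ → GridFun) (k : ℕ),
      Ψ k = cellRestrict h (Φ t) → Ψ (k + 1) = cellRestrict h (Φ (t + s)) →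
      extrapLevel Ψ k = cellRestrict h E → ∀ i j, |Ψ (k + 1) i j - Ψ k i j
        - s * gridLaplacian h (P.discretePotential m n h Ψ k) i j| ≤ s * (M * (h ^ 2 + r)) := by
    intro t ρ r E ht0 hts hr hρ hE Ψ k e1 e2 e3 i j
    rw [discretePotential_cellRestrict P m n h e1 e2 e3, gridLaplacian_cellRestrict, e1, e2]
    refine (hK m n h s t ρ E hg ht0 hs hts hE _).trans (mul_le_mul_of_nonneg_left ?_ hs.le)
    have hr0 : 0 ≤ r := (sq_nonneg s).trans hr
    have b1 : (6 + A) * K ^ 2 * (h ^ 2 + s ^ 2) ≤ (6 + A) * K ^ 2 * (h ^ 2 + r) :=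
      mul_le_mul_of_nonneg_left (by linarith) (by positivity)
    have b2 : (2 + 2 * A) * K * ρ ≤ (2 + 2 * A) * K * (|Kt| * r) :=
      mul_le_mul_of_nonneg_left hρ (by positivity)
    have b3 : 0 ≤ (2 + 2 * A) * K * |Kt| * h ^ 2 := by positivity
    have b4 : R * (h ^ 2 + r) ≤ M * (h ^ 2 + r) :=
      mul_le_mul_of_nonneg_right (by linarith) (by positivity)
    rw [hR] at b4
    linarith
  refine ⟨?_, ?_, ?_, ?_⟩
  · have := abs_le.1 (abs_gridMass_le hg (f := vertexRestrict h P.Jc) (K := Kc) fun k l => by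
      rw [vertexRestrict_apply]; exact hc 0 mem0 _)
    rw [← hA] at this
    unfold Model.Bc
    linarith [this.2]
  · intro k l
    rw [vertexRestrict_apply, vertexRestrict_apply]
    have := ((hj 0 mem0 !₂[(k : ℝ) * h, (l : ℝ) * h]).2 0 h).1
    rw [vec₂_add_smul_zero, abs_of_pos hh] at this
    push_cast
    rw [add_mul, one_mul]
    exact this.trans (mul_le_mul_of_nonneg_right (by linarith [le_abs_self Kj]) hh.le)
  · intro k l
    rw [vertexRestrict_apply, vertexRestrict_apply]
    have := ((hj 0 mem0 !₂[(k : ℝ) * h, (l : ℝ) * h]).2 1 h).1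
    rw [vec₂_add_smul_one, abs_of_pos hh] at this
    push_cast
    rw [add_mul, one_mul]
    exact this.trans (mul_le_mul_of_nonneg_right (by linarith [le_abs_self Kj]) hh.le)
  intro Ψ hΨ
  have succ_mul : ∀ k : ℕ, ((k + 1 : ℕ) : ℝ) * s = k * s + s := fun k => by push_cast; ring
  refine ⟨?_, ?_, ?_, ?_⟩
  · intro k hk i j
    rw [hΨ]
    exact (h₀ _ ⟨by positivity, hk⟩ _).1.trans (by linarith [le_abs_self K₀])
  · intro k hk i j
    rw [hΨ, hΨ, succ_mul]
    rw [succ_mul] at hk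
    exact ((ht (k * s) s (by positivity) hs hk).1 _).1.trans
      (mul_le_mul_of_nonneg_right (by linarith [le_abs_self Kt]) hs.le)
  · intro hk
    rw [one_mul] at hk
    -- Since the previous level of the first step is the initial level itself, the extrapolation
    -- collapses to `Φ 0`, at distance O(s) from the half time.
    refine final 0 (Kt * s) s (Φ 0) le_rfl (by linarith) (by nlinarith)
      (mul_le_mul_of_nonneg_right (le_abs_self _) hs.le)
      (ht 0 s le_rfl hs (by linarith)).2.1 Ψ 0 ?_ ?_ ?_
    · rw [hΨ]; simp
    · rw [hΨ]; simp
    · funext i j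
      simp only [extrapLevel, prevLevel, hΨ, Nat.cast_zero, zero_mul, cellRestrict]
      ring
  · intro k hk
    rw [succ_mul (k + 1), succ_mul k] at hk
    have hks : 0 ≤ (k : ℝ) * s := by positivity
    refine final (k * s + s) (Kt * s ^ 2) (s ^ 2) (fun x => 3 / 2 * Φ (k * s + s) x
      - 1 / 2 * Φ (k * s + s - s) x) (by positivity) hk le_rfl
      (mul_le_mul_of_nonneg_right (le_abs_self _) (sq_nonneg s))
      ((ht (k * s + s) s (by positivity) hs hk).2.2.2.1 (by linarith)) Ψ (k + 1) ?_ ?_ ?_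
    · rw [hΨ, succ_mul]
    · rw [hΨ, succ_mul, succ_mul]
    · funext i j
      simp only [extrapLevel, prevLevel, hΨ, succ_mul, cellRestrict, add_sub_cancel_right]

end NonlocalCH

end

/-! ### Convergence from consistency and stability. -/

theorem mainTheorem2 (P : NonlocalCH.Model) (hP : P.Admissible)
    -- the condition `B_c - 3 B_e ≥ α₀ > 0` on all sufficiently fine grids
    (α₀ h₁ : ℝ) (hα₀ : 0 < α₀) (hh₁ : 0 < h₁)
    (hB : ∀ (m n : ℕ) (h : ℝ), NonlocalCH.IsGrid P.L₁ P.L₂ m n h → h ≤ h₁ →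
      α₀ ≤ P.Bc m n h - 3 * P.Be m n h)
    -- the exact solution
    (T : ℝ) (hT : 0 < T) (Φ : ℝ → NonlocalCH.Plane → ℝ) (hΦ : P.IsSmoothSolution T Φ)
    -- the constant of the refinement path `s ≤ κ h`
    (κ : ℝ) (hκ : 0 < κ) :
    ∃ h₀ > 0, ∃ s₀ > 0, ∃ C > 0,
      ∀ (m n : ℕ) (h s : ℝ), NonlocalCH.IsGrid P.L₁ P.L₂ m n h → h ≤ h₀ →
        0 < s → s ≤ s₀ → s ≤ κ * h →
        ∀ φ : ℕ → NonlocalCH.GridFun, P.IsSchemeSolution m n h s T (Φ 0) φ →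
          ∀ l : ℕ, 0 < l → (l : ℝ) * s ≤ T →
            NonlocalCH.gridNorm m n h
                (fun i j => NonlocalCH.cellRestrict h (Φ (l * s)) i j - φ l i j)
              ≤ C * (h ^ 2 + s ^ 2) := by
  obtain ⟨M, hM1, hTM, hM⟩ := NonlocalCH.exists_consistency P hP hT hΦ
  obtain ⟨s₀, hs₀, C, hC, stab⟩ := NonlocalCH.scheme_stability P.L₁ P.L₂ α₀ M
    (mul_pos hP.L₁_pos hP.L₂_pos) hα₀ hM1
  refine ⟨min h₁ 1, by positivity, min s₀ 1, by positivity, Real.sqrt C, Real.sqrt_pos.2 hC, ?_⟩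
  intro m n h s hg hh hs hs1 _ φ hφ l _ hl
  obtain ⟨bc, j1, j2, hΨ⟩ := hM m n h s hg hs (hs1.trans (min_le_right _ _))
  obtain ⟨b1, b2, r0, r1⟩ := hΨ (fun k => NonlocalCH.cellRestrict h (Φ (k * s))) fun _ => rfl
  have le_T : ∀ k ≤ l, (k : ℝ) * s ≤ T := fun k hk =>
    (mul_le_mul_of_nonneg_right (Nat.cast_le.2 hk) hs.le).trans hl
  -- Together with B_c − 3B_e ≥ α₀, this sign yields B_c − B_e ≥ α₀, the coercivity in the relative
  -- energy.
  have hbe : 0 ≤ P.Be m n h := add_nonneg (NonlocalCH.gridSum_nonneg fun k l => hP.Je_nonneg _)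
    hP.γe_nonneg
  have hb := hB m n h hg (hh.trans (min_le_left _ _))
  have main := stab m n h s hg (hh.trans (min_le_right _ _)) hs (hs1.trans (min_le_left _ _))
    (P.Bc m n h) (P.Be m n h) (NonlocalCH.vertexRestrict h P.J) (by linarith) hbe bc
    (NonlocalCH.isGridPeriodic_vertexRestrict hg hP.J_periodic) j1 j2
    (fun k => NonlocalCH.cellRestrict h (Φ (k * s))) φ l (hl.trans hTM)
    (by rw [hφ.initial]; simp) (fun k hk => hφ.periodic k (le_T k hk))
    (fun k hk => NonlocalCH.isGridPeriodic_cellRestrict hg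
      (hΦ.periodic _ ⟨by positivity, le_T k hk⟩))
    (fun k hk => b1 k (le_T k hk)) (fun k hk => b2 k (le_T _ hk))
    (fun k hk => hφ.step k (le_T _ hk))
    (fun i j h0 => r0 (by simpa using le_T 1 h0) i j)
    (fun k hk => r1 k (le_T _ hk))
  have e : NonlocalCH.gridNorm m n h
      (fun i j => NonlocalCH.cellRestrict h (Φ (l * s)) i j - φ l i j)
      = Real.sqrt (NonlocalCH.gridSum m n h (fun i j =>
        (φ l i j - NonlocalCH.cellRestrict h (Φ (l * s)) i j) ^ 2)) := by
    simp only [NonlocalCH.gridNorm, NonlocalCH.gridSum, sub_sq_comm]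
  rw [e]
  refine (Real.sqrt_le_sqrt main).trans (le_of_eq ?_)
  rw [Real.sqrt_mul hC.le, Real.sqrt_sq (by positivity)]
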